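/- All graphs are finite, simple and connected. Let $\Gamma$ be a graph with a chosen base vertex and a chosen linear ordering of its edges. A \emph{reduced enhanced state} of $\Gamma$ is a spanning subgraph (all the vertices and a subset of the edges) whose connected components are coloured by $1$ or $x$, the component of the base vertex being coloured by $x$; its dimension is its number of edges and its degree is the number of components coloured by $x$, minus $1$. Let $\widetilde C^{i,j}(\Gamma)$ be the real vector space with basis the reduced enhanced states of dimension $i$ and degree $j$. The differential $d:\widetilde C^{i,j}(\Gamma)\to\widetilde C^{i+1,j}(\Gamma)$ sends a state $S$ to $\sum_{e\notin S}(-1)^{n(S,e)}\,(S\cup e)$, where $n(S,e)$ is the number of edges of $S$ that precede $e$; here $S\cup e$ keeps the colouring of $S$ if $e$ joins two vertices of one component of $S$, and if $e$ joins two different components, the new component is coloured by the product of their colours under $1\cdot 1=1$, $1\cdot x=x\cdot 1=x$, $x\cdot x=0$ (the term is $0$ if the product is $0$). Put $\widetilde H^{i,j}(\Gamma)=\ker(d:\widetilde C^{i,j}\to\widetilde C^{i+1,j})/\operatorname{im}(d:\widetilde C^{i-1,j}\to\widetilde C^{i,j})$. Let $\Gamma_1,\Gamma_2$ be graphs, let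 $v_1$ be a vertex of $\Gamma_1$ and $v_2$ a vertex of $\Gamma_2$, and let $\Gamma=\Gamma_1*\Gamma_2$ be the graph obtained from the disjoint union of $\Gamma_1$ and $\Gamma_2$ by identifying $v_1$ with $v_2$. Then, for arbitrary choices of the base vertices and of the edge orderings of $\Gamma$, $\Gamma_1$ and $\Gamma_2$, $\widetilde H(\Gamma)\cong\widetilde H(\Gamma_1)\otimes\widetilde H(\Gamma_2)$ as bigraded real vector spaces; that is, for all integers $i,j$, $$\widetilde H^{i,j}(\Gamma)\;\cong\;\bigoplus_{p,q\in\mathbb Z}\widetilde H^{p,q}(\Gamma_1)\otimes_{\mathbb R}\widetilde H^{i-p,\,j-q}(\Gamma_2).$$ -/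

import Mathlib

open scoped TensorProduct DirectSum

namespace ReducedChromatic

universe u v

/-- The two colours of the connected components of an enhanced state
(the basis `1, x` of the algebra `ℝ[x]/(x²)`). -/
inductive Color : Type
  | one : Color
  | x : Color

section Complex

/-! A graph is given here by its vertex type `V`, its edge type `E` and the map `ends` which sends
an edge to its unordered pair of end points; `b : V` is the base point. -/

variable {V : Type u} {E : Type v}

/-- The spanning subgraph with edge set `s`, as a simple graph: it has the same connected
components as the state `s`. -/
def stateGraph (ends : E → Sym2 V) (s : Finset E) : SimpleGraph V :=
  SimpleGraph.fromEdgeSet (ends '' (s : Set E))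

/-- A reduced enhanced state: a spanning subgraph (given by its set of edges) together with a
colouring of its connected components by `1` and `x`, the component of the base point being
coloured by `x`.  A colouring of the components is recorded as a colouring of the vertices which
is constant on each component. -/
@[ext]
structure EnhancedState (ends : E → Sym2 V) (b : V) where
  edges : Finset E
  color : V → Color
  color_eq : ∀ v w, (stateGraph ends edges).Reachable v w → color v = color w
  color_base : color b = Color.x

/-- The degree of an enhanced state: the number of components coloured by `x`, minus `1`. -/
noncomputable def EnhancedState.degree {ends : E → Sym2 V} {b : V}
    (S : EnhancedState ends b) : ℤ :=
  ({K : (stateGraph ends S.edges).ConnectedComponent |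
      ∃ v, (stateGraph ends S.edges).connectedComponentMk v = K ∧ S.color v = Color.x}.ncard : ℤ)
    - 1

/-- The real vector space spanned by all reduced enhanced states. -/
abbrev Cochain (ends : E → Sym2 V) (b : V) : Type (max u v) :=
  EnhancedState ends b →₀ ℝ

noncomputable instance (ends : E → Sym2 V) (b : V) : AddCommGroup (Cochain ends b) :=
  Finsupp.instAddCommGroup

/-- The cochain group `C^{i,j}`: the span of the enhanced states with `i` edges and degree `j`. -/
def cochainGroup (ends : E → Sym2 V) (b : V) (i j : ℤ) : Submodule ℝ (Cochain ends b) :=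
  Finsupp.supported ℝ ℝ {S : EnhancedState ends b | (S.edges.card : ℤ) = i ∧ S.degree = j}

open scoped Classical in
/-- The colouring of the components of `S ∪ e`: a component `K` of `S ∪ e` is coloured by the
product of the colours of the components of `S` contained in `K`.  Since `1` is a unit and
`x * x = 0`, a product of colours which does not vanish is `x` if some factor is `x`, and is `1`
otherwise. -/
noncomputable def EnhancedState.mergedColor {ends : E → Sym2 V} {b : V}
    (S : EnhancedState ends b) (e : E) (v : V) : Color :=
  if ∃ w, (stateGraph ends (insert e S.edges)).Reachable v w ∧ S.color w = Color.x
  then Color.x else Color.one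

open scoped Classical in
/-- No component of `S ∪ e` contains two different components of `S` which are both coloured
by `x`, i.e. no product `x * x = 0` occurs when `e` is added to `S`. -/
def EnhancedState.Mergeable {ends : E → Sym2 V} {b : V}
    (S : EnhancedState ends b) (e : E) : Prop :=
  ∀ v w, (stateGraph ends (insert e S.edges)).Reachable v w →
    S.color v = Color.x → S.color w = Color.x → (stateGraph ends S.edges).Reachable v w

open scoped Classical in
/-- The enhanced state `S ∪ e` with its merged colouring (without sign). -/
noncomputable def EnhancedState.insertEdge {ends : E → Sym2 V} {b : V}
    (S : EnhancedState ends b) (e : E) : EnhancedState ends b where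
  edges := insert e S.edges
  color := S.mergedColor e
  color_eq v w h := by
    unfold EnhancedState.mergedColor
    congr 1
    exact propext ⟨fun ⟨z, hz, hc⟩ => ⟨z, h.symm.trans hz, hc⟩,
      fun ⟨z, hz, hc⟩ => ⟨z, h.trans hz, hc⟩⟩
  color_base := by
    unfold EnhancedState.mergedColor
    exact if_pos ⟨b, SimpleGraph.Reachable.refl b, S.color_base⟩

open scoped Classical in
/-- The number of edges of `S` which precede `e` in the ordering `o` of the edges. -/
noncomputable def EnhancedState.precedingEdges {ends : E → Sym2 V} {b : V}
    (o : LinearOrder E) (S : EnhancedState ends b) (e : E) : ℕ :=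
  (S.edges.filter fun f => o.lt f e).card

open scoped Classical in
/-- The differential: the signed sum, over all edges `e` which are not in `S`, of the states
obtained by adding `e` to `S`; a term in which a product `x * x = 0` occurs vanishes. -/
noncomputable def differential [Finite E] (ends : E → Sym2 V) (o : LinearOrder E) (b : V) :
    Cochain ends b →ₗ[ℝ] Cochain ends b :=
  letI := Fintype.ofFinite E
  Finsupp.linearCombination ℝ fun S : EnhancedState ends b =>
    ∑ e ∈ Finset.univ.filter (fun e => e ∉ S.edges),
      if S.Mergeable e then
        Finsupp.single (S.insertEdge e) ((-1 : ℝ) ^ S.precedingEdges o e)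
      else 0

/-- The cocycles `Ker (d : C^{i,j} → C^{i+1,j})`. -/
noncomputable def cocycles [Finite E] (ends : E → Sym2 V) (o : LinearOrder E) (b : V) (i j : ℤ) :
    Submodule ℝ (Cochain ends b) :=
  cochainGroup ends b i j ⊓ LinearMap.ker (differential ends o b)

/-- The coboundaries `Im (d : C^{i-1,j} → C^{i,j})`. -/
noncomputable def coboundaries [Finite E] (ends : E → Sym2 V) (o : LinearOrder E) (b : V)
    (i j : ℤ) : Submodule ℝ (Cochain ends b) :=
  (cochainGroup ends b (i - 1) j).map (differential ends o b)

/-- The cohomology group `Ker (d : C^{i,j} → C^{i+1,j}) / Im (d : C^{i-1,j} → C^{i,j})`. -/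
abbrev Cohomology [Finite E] (ends : E → Sym2 V) (o : LinearOrder E) (b : V) (i j : ℤ) :
    Type (max u v) :=
  cocycles ends o b i j ⧸ (coboundaries ends o b i j).submoduleOf (cocycles ends o b i j)

end Complex

/-- The reduced chromatic cohomology group in bidegree `(i, j)` of the finite simple graph `Γ`
with base point `b`, computed with the ordering `o` of the edges of `Γ`. -/
abbrev GraphCohomology {V : Type u} [Finite V] (Γ : SimpleGraph V) (o : LinearOrder Γ.edgeSet)
    (b : V) (i j : ℤ) : Type u :=
  Cohomology (fun e : Γ.edgeSet => (e : Sym2 V)) o b i j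

/-- The relation on the disjoint union of two vertex sets which identifies `v₁` with `v₂`. -/
inductive GlueRel {V₁ : Type u} {V₂ : Type v} (v₁ : V₁) (v₂ : V₂) : V₁ ⊕ V₂ → V₁ ⊕ V₂ → Prop
  | glue : GlueRel v₁ v₂ (Sum.inl v₁) (Sum.inr v₂)

/-- The vertex set of `Γ₁ * Γ₂`: the disjoint union of the vertex sets, with `v₁` and `v₂`
identified. -/
def GlueVertex {V₁ : Type u} {V₂ : Type v} (v₁ : V₁) (v₂ : V₂) : Type (max u v) :=
  Quot (GlueRel v₁ v₂)

instance {V₁ : Type u} {V₂ : Type v} [Finite V₁] [Finite V₂] (v₁ : V₁) (v₂ : V₂) :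
    Finite (GlueVertex v₁ v₂) :=
  inferInstanceAs (Finite (Quot (GlueRel v₁ v₂)))

/-- The one vertex union `Γ₁ * Γ₂`, which glues `v₁` in `Γ₁` to `v₂` in `Γ₂`: the image of the
disjoint union of `Γ₁` and `Γ₂` under the identification of `v₁` with `v₂`. -/
def vertexUnion {V₁ : Type u} {V₂ : Type v} (Γ₁ : SimpleGraph V₁) (Γ₂ : SimpleGraph V₂)
    (v₁ : V₁) (v₂ : V₂) : SimpleGraph (GlueVertex v₁ v₂) :=
  (Γ₁ ⊕g Γ₂).map (Quot.mk (GlueRel v₁ v₂))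

end ReducedChromatic

/-! Finite-dimensional real vector spaces are classified by dimension, so it suffices to compare
dimensions in each bidegree; no Künneth map is constructed. The dimensions turn out to depend on
neither the base vertex nor the edge ordering, so those choices play no role.

Write k(s) for the number of components of the spanning subgraph s. Two facts determine everything.
First, the cohomology of a connected graph is thin: it vanishes unless i + j = k(∅) - 1, which is
the number of vertices minus 1 (`isThin_univ`). So in each degree j at most one group survives, and
its dimension is, up to sign, the Euler characteristic in degree j, which is the j-th coefficient of
∑_s (-1)^|s| (1+X)^(k(s)-1) (`finrank_cohomology_diagonal`). Secondly, this polynomial is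
multiplicative under gluing at a vertex (`eulerPoly_vertexUnion`), because k - 1 is additive.

Thinness is proved by deletion and contraction inside the fixed graph, so that states and signs
never change: T is the set of contracted edges, U the set of edges not deleted, and B a set of
vertices forced to have colour x, one in each component of U. The induction on |U \ T|
(`isThin_of_components`) treats an edge e of U \ T in three ways. If e is a loop modulo T, toggling
e makes the complex acyclic. If e is not a bridge of U, the exact sequence of deletion and
contraction applies. If e is a bridge with one end already coloured x, cancelling pairs of states
leaves the complex in which e is deleted and its other end joins B. The diagonal |T| + k(T) - 1 is
the same throughout. -/

namespace ReducedChromatic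

universe u v

open scoped Classical

/-! ### Components of a state and the effect of adding one edge. -/

section Reachability

variable {V : Type u} {E : Type v} {ends : E → Sym2 V}

theorem stateGraph_mono {s t : Finset E} (h : s ⊆ t) : stateGraph ends s ≤ stateGraph ends t :=
  SimpleGraph.fromEdgeSet_mono (Set.image_mono (by exact_mod_cast h))

theorem reachable_mono {s t : Finset E} (h : s ⊆ t) {v w : V}
    (hr : (stateGraph ends s).Reachable v w) : (stateGraph ends t).Reachable v w :=
  hr.mono (stateGraph_mono h)

theorem reachable_of_mem {s : Finset E} {e : E} (he : e ∈ s) {v w : V} (hvw : ends e = s(v, w)) :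
    (stateGraph ends s).Reachable v w := by
  by_cases h : v = w
  · exact h ▸ SimpleGraph.Reachable.refl _
  · refine SimpleGraph.Adj.reachable ?_
    exact ⟨⟨e, by exact_mod_cast he, hvw⟩, h⟩

/-- A property which is transported along the edges of a state is transported along its
components. -/
theorem Reachable.induct {s : Finset E} {P : V → Prop}
    (h : ∀ e ∈ s, ∀ v w, ends e = s(v, w) → P v → P w) {v w : V}
    (hr : (stateGraph ends s).Reachable v w) (hv : P v) : P w := by
  obtain ⟨p⟩ := hr
  induction p with
  | nil => exact hv
  | cons hadj _ ih =>
    obtain ⟨⟨e, he, hvw⟩, -⟩ := hadj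
    exact ih (h e (by exact_mod_cast he) _ _ hvw hv)

theorem reachable_insert_iff {s : Finset E} {e : E} {v w : V} (he : ends e = s(v, w)) {a c : V} :
    (stateGraph ends (insert e s)).Reachable a c ↔
      (stateGraph ends s).Reachable a c ∨
      ((stateGraph ends s).Reachable a v ∧ (stateGraph ends s).Reachable w c) ∨
      ((stateGraph ends s).Reachable a w ∧ (stateGraph ends s).Reachable v c) := by
  constructor
  · intro h
    refine Reachable.induct (s := insert e s) (P := fun c => (stateGraph ends s).Reachable a c ∨
      ((stateGraph ends s).Reachable a v ∧ (stateGraph ends s).Reachable w c) ∨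
      ((stateGraph ends s).Reachable a w ∧ (stateGraph ends s).Reachable v c)) ?_ h
      (Or.inl (SimpleGraph.Reachable.refl _))
    intro f hf p q hpq hp
    rcases Finset.mem_insert.1 hf with rfl | hf
    · rw [he, Sym2.eq_iff] at hpq
      rcases hpq with ⟨rfl, rfl⟩ | ⟨rfl, rfl⟩
      · rcases hp with h | h | h
        · exact Or.inr (Or.inl ⟨h, .refl _⟩)
        · exact Or.inr (Or.inl ⟨h.1, .refl _⟩)
        · exact Or.inl h.1
      · rcases hp with h | h | h
        · exact Or.inr (Or.inr ⟨h, .refl _⟩)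
        · exact Or.inl h.1
        · exact Or.inr (Or.inr ⟨h.1, .refl _⟩)
    · have hr := reachable_of_mem hf hpq
      rcases hp with h | h | h
      · exact Or.inl (h.trans hr)
      · exact Or.inr (Or.inl ⟨h.1, h.2.trans hr⟩)
      · exact Or.inr (Or.inr ⟨h.1, h.2.trans hr⟩)
  · have hs := Finset.subset_insert e s
    have hr := reachable_of_mem (Finset.mem_insert_self e s) he
    rintro (h | h | h)
    · exact reachable_mono hs h
    · exact (reachable_mono hs h.1).trans (hr.trans (reachable_mono hs h.2))
    · exact (reachable_mono hs h.1).trans (hr.symm.trans (reachable_mono hs h.2))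

theorem reachable_insert_iff_of_reachable {s : Finset E} {e : E} {v w : V}
    (he : ends e = s(v, w)) (hr : (stateGraph ends s).Reachable v w) {a c : V} :
    (stateGraph ends (insert e s)).Reachable a c ↔ (stateGraph ends s).Reachable a c := by
  rw [reachable_insert_iff he]
  exact ⟨fun h => h.elim id fun h => h.elim (fun h => h.1.trans (hr.trans h.2))
    fun h => h.1.trans (hr.symm.trans h.2), Or.inl⟩

/-- The number of components of a state. -/
noncomputable def numComponents (ends : E → Sym2 V) (s : Finset E) : ℕ :=
  Nat.card (stateGraph ends s).ConnectedComponent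

theorem numComponents_insert [Finite V] {s : Finset E} {e : E} {v w : V}
    (he : ends e = s(v, w)) (hr : ¬ (stateGraph ends s).Reachable v w) :
    numComponents ends (insert e s) + 1 = numComponents ends s := by
  have : Fintype V := Fintype.ofFinite V
  -- The new edge only absorbs the component of `w` into that of `v`, so the other components of `s`
  -- represent each component of the larger state once.
  let K₀ := (stateGraph ends s).connectedComponentMk w
  let f : {K : (stateGraph ends s).ConnectedComponent // K ≠ K₀} →
      (stateGraph ends (insert e s)).ConnectedComponent := fun K =>
    K.1.map (SimpleGraph.Hom.ofLE (stateGraph_mono (Finset.subset_insert e s)))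
  have hf : Function.Bijective f := by
    constructor
    · rintro ⟨K, hK⟩ ⟨L, hL⟩ h
      induction K using SimpleGraph.ConnectedComponent.ind with | _ a
      induction L using SimpleGraph.ConnectedComponent.ind with | _ c
      have h' : (stateGraph ends (insert e s)).Reachable a c :=
        SimpleGraph.ConnectedComponent.exact h
      rw [reachable_insert_iff he] at h'
      rcases h' with h' | h' | h'
      · exact Subtype.ext (SimpleGraph.ConnectedComponent.sound h')
      · exact absurd (SimpleGraph.ConnectedComponent.sound h'.2.symm) hL
      · exact absurd (SimpleGraph.ConnectedComponent.sound h'.1) hK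
    · intro K
      induction K using SimpleGraph.ConnectedComponent.ind with | _ a
      by_cases ha : (stateGraph ends s).Reachable a w
      · refine ⟨⟨(stateGraph ends s).connectedComponentMk v,
          fun h => hr (SimpleGraph.ConnectedComponent.exact h)⟩, ?_⟩
        refine SimpleGraph.ConnectedComponent.sound ?_
        rw [SimpleGraph.Hom.coe_ofLE, id, reachable_insert_iff he]
        exact Or.inr (Or.inl ⟨.refl _, ha.symm⟩)
      · exact ⟨⟨(stateGraph ends s).connectedComponentMk a,
          fun h => ha (SimpleGraph.ConnectedComponent.exact h)⟩, rfl⟩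
  have h1 := Nat.card_eq_of_bijective f hf
  have h2 := Finite.card_subtype_lt (p := fun K => K ≠ K₀) (x := K₀) (by simp)
  have h3 : Nat.card {K // K ≠ K₀} + 1 = Nat.card (stateGraph ends s).ConnectedComponent := by
    rw [← Nat.card_congr (Equiv.optionSubtypeNe K₀), Finite.card_option]
  rw [numComponents, numComponents, ← h1, h3]

end Reachability

/-! ### Adding edges to enhanced states: colours, degree and signs. -/

section States

variable {V : Type u} {E : Type v} {ends : E → Sym2 V} {b : V}

instance : Finite Color :=
  Finite.of_injective (fun c : Color => (match c with | .one => true | .x => false : Bool)) (by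
    rintro (_ | _) (_ | _) h <;> simp_all)

theorem Color.eq_one_of_ne {c : Color} (h : c ≠ Color.x) : c = Color.one := by
  cases c
  · rfl
  · exact absurd rfl h

theorem Color.eq_of_iff {c d : Color} (h : c = Color.x ↔ d = Color.x) : c = d := by
  cases c <;> cases d <;> simp_all

instance [Finite V] [Finite E] : Finite (EnhancedState ends b) :=
  Finite.of_injective (fun S : EnhancedState ends b => (S.edges, S.color)) fun _ _ h =>
    EnhancedState.ext (congrArg Prod.fst h) (congrArg Prod.snd h)

namespace EnhancedState

theorem mergedColor_eq_x_iff (S : EnhancedState ends b) (e : E) (v : V) :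
    S.mergedColor e v = Color.x ↔
      ∃ w, (stateGraph ends (insert e S.edges)).Reachable v w ∧ S.color w = Color.x := by
  unfold mergedColor
  split_ifs with h <;> simp [h]

theorem insertEdge_color_eq_x_iff (S : EnhancedState ends b) (e : E) (v : V) :
    (S.insertEdge e).color v = Color.x ↔
      ∃ w, (stateGraph ends (insert e S.edges)).Reachable v w ∧ S.color w = Color.x :=
  S.mergedColor_eq_x_iff e v

@[simp] theorem insertEdge_edges (S : EnhancedState ends b) (e : E) :
    (S.insertEdge e).edges = insert e S.edges := rfl

theorem insertEdge_color_of_color (S : EnhancedState ends b) (e : E) {v : V}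
    (h : S.color v = Color.x) : (S.insertEdge e).color v = Color.x :=
  (S.insertEdge_color_eq_x_iff e v).2 ⟨v, .refl _, h⟩

/-- The right-hand side depends on `e` and `f` only through the set with both edges added, so the
vanishing of a double term does not depend on the order of insertion. -/
theorem mergeable_mergeable_iff (S : EnhancedState ends b) (e f : E) :
    (S.Mergeable e ∧ (S.insertEdge e).Mergeable f) ↔
      ∀ v w, (stateGraph ends (insert f (insert e S.edges))).Reachable v w →
        S.color v = Color.x → S.color w = Color.x → (stateGraph ends S.edges).Reachable v w := by
  have hs := Finset.subset_insert f (insert e S.edges)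
  constructor
  · rintro ⟨h1, h2⟩ v w hr hv hw
    exact h1 v w (h2 v w hr (S.insertEdge_color_of_color e hv)
      (S.insertEdge_color_of_color e hw)) hv hw
  · refine fun h => ⟨fun v w hr => h v w (reachable_mono hs hr), fun v w hr hv hw => ?_⟩
    obtain ⟨v', hv', hv⟩ := (S.insertEdge_color_eq_x_iff e v).1 hv
    obtain ⟨w', hw', hw⟩ := (S.insertEdge_color_eq_x_iff e w).1 hw
    have := h v' w' (((reachable_mono hs hv').symm.trans hr).trans (reachable_mono hs hw')) hv hw
    exact (hv'.trans (reachable_mono (Finset.subset_insert _ _) this)).trans hw'.symm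

theorem insertEdge_insertEdge_color_eq_x_iff (S : EnhancedState ends b) (e f : E) (v : V) :
    ((S.insertEdge e).insertEdge f).color v = Color.x ↔
      ∃ w, (stateGraph ends (insert f (insert e S.edges))).Reachable v w ∧
        S.color w = Color.x := by
  rw [insertEdge_color_eq_x_iff]
  constructor
  · rintro ⟨w, hw, hc⟩
    obtain ⟨z, hz, hc⟩ := (S.insertEdge_color_eq_x_iff e w).1 hc
    exact ⟨z, hw.trans (reachable_mono (Finset.subset_insert _ _) hz), hc⟩
  · rintro ⟨w, hw, hc⟩
    exact ⟨w, hw, S.insertEdge_color_of_color e hc⟩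

theorem insertEdge_comm (S : EnhancedState ends b) (e f : E) :
    (S.insertEdge e).insertEdge f = (S.insertEdge f).insertEdge e := by
  refine EnhancedState.ext (Finset.insert_comm f e S.edges) (funext fun v => Color.eq_of_iff ?_)
  rw [insertEdge_insertEdge_color_eq_x_iff, insertEdge_insertEdge_color_eq_x_iff,
    Finset.insert_comm]

theorem mergeable_comm (S : EnhancedState ends b) (e f : E) :
    (S.Mergeable e ∧ (S.insertEdge e).Mergeable f) ↔
      (S.Mergeable f ∧ (S.insertEdge f).Mergeable e) := by
  rw [mergeable_mergeable_iff, mergeable_mergeable_iff, Finset.insert_comm]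

/-- Every x-component of the new state contains an x-component of `S`, and mergeability says that it
contains only one. -/
theorem degree_insertEdge (S : EnhancedState ends b) {e : E} (h : S.Mergeable e) :
    (S.insertEdge e).degree = S.degree := by
  have hle := stateGraph_mono (ends := ends) (Finset.subset_insert e S.edges)
  unfold degree
  congr 2
  symm
  refine Set.ncard_congr (fun K _ => K.map (SimpleGraph.Hom.ofLE hle)) ?_ ?_ ?_
  · rintro K ⟨v, rfl, hv⟩
    exact ⟨v, rfl, S.insertEdge_color_of_color e hv⟩
  · rintro K L ⟨v, rfl, hv⟩ ⟨w, rfl, hw⟩ hKL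
    exact SimpleGraph.ConnectedComponent.sound
      (h v w (SimpleGraph.ConnectedComponent.exact hKL) hv hw)
  · rintro K ⟨v, rfl, hv⟩
    obtain ⟨w, hw, hc⟩ := (S.insertEdge_color_eq_x_iff e v).1 hv
    exact ⟨_, ⟨w, rfl, hc⟩, SimpleGraph.ConnectedComponent.sound hw.symm⟩

theorem degree_nonneg [Finite V] (S : EnhancedState ends b) : 0 ≤ S.degree := by
  unfold degree
  have : (0 : ℕ) < {K : (stateGraph ends S.edges).ConnectedComponent |
      ∃ v, (stateGraph ends S.edges).connectedComponentMk v = K ∧ S.color v = Color.x}.ncard :=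
    (Set.ncard_pos (Set.toFinite _)).2 ⟨_, b, rfl, S.color_base⟩
  omega

/-- The sign with which the state `S ∪ e` occurs in the differential of `S`. -/
noncomputable def sign (o : LinearOrder E) (S : EnhancedState ends b) (e : E) : ℝ :=
  (-1) ^ S.precedingEdges o e

theorem sign_ne_zero (o : LinearOrder E) (S : EnhancedState ends b) (e : E) : S.sign o e ≠ 0 :=
  pow_ne_zero _ (by norm_num)

theorem card_filter_insert {s : Finset E} {e : E} (he : e ∉ s) (p : E → Prop) :
    ((insert e s).filter p).card = (s.filter p).card + if p e then 1 else 0 := by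
  rw [Finset.filter_insert]
  split_ifs with h
  · rw [Finset.card_insert_of_notMem (by simp [he])]
  · rfl

theorem precedingEdges_insertEdge (o : LinearOrder E) (S : EnhancedState ends b) {e : E}
    (he : e ∉ S.edges) (f : E) : (S.insertEdge e).precedingEdges o f =
      S.precedingEdges o f + @ite ℕ (o.lt e f) (Classical.propDecidable _) 1 0 := by
  have h := card_filter_insert he fun g => o.lt g f
  unfold precedingEdges
  rw [insertEdge_edges]
  convert h

/-- Exactly one of `e`, `f` precedes the other, so exactly one of the two orders of insertion picks
up an extra factor -1. -/
theorem sign_mul_sign (o : LinearOrder E) (S : EnhancedState ends b) {e f : E}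
    (he : e ∉ S.edges) (hf : f ∉ S.edges) (hef : e ≠ f) :
    S.sign o e * (S.insertEdge e).sign o f = -(S.sign o f * (S.insertEdge f).sign o e) := by
  unfold sign
  rw [precedingEdges_insertEdge o S he, precedingEdges_insertEdge o S hf]
  rcases lt_or_gt_of_ne hef with h | h
  · rw [if_pos h, if_neg h.not_gt]
    ring
  · rw [if_neg h.not_gt, if_pos h]
    ring

end EnhancedState

end States

end ReducedChromatic

/-! ### The differential edge by edge, and cancellation of states by toggling an edge. -/

namespace ReducedChromatic

universe u v

open scoped Classical

section Supported

variable {α : Type*} {M : Type*} [AddCommGroup M] [Module ℝ M]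

theorem map_mem_of_mem_supported (L : (α →₀ ℝ) →ₗ[ℝ] M) {s : Set α} {N : Submodule ℝ M}
    (h : ∀ a ∈ s, L (Finsupp.single a 1) ∈ N) {z : α →₀ ℝ} (hz : z ∈ Finsupp.supported ℝ ℝ s) :
    L z ∈ N := by
  have : Finsupp.supported ℝ ℝ s ≤ N.comap L := by
    rw [Finsupp.supported_eq_span_single, Submodule.span_le]
    rintro _ ⟨a, ha, rfl⟩
    exact h a ha
  exact this hz

theorem map_eq_of_mem_supported (L L' : (α →₀ ℝ) →ₗ[ℝ] M) {s : Set α}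
    (h : ∀ a ∈ s, L (Finsupp.single a 1) = L' (Finsupp.single a 1)) {z : α →₀ ℝ}
    (hz : z ∈ Finsupp.supported ℝ ℝ s) : L z = L' z := by
  have := map_mem_of_mem_supported (L - L') (s := s) (N := ⊥)
    (fun a ha => by simp [h a ha]) hz
  simpa [sub_eq_zero] using this

theorem exists_add_of_mem_supported (p : Set α) {s : Set α} {z : α →₀ ℝ}
    (hz : z ∈ Finsupp.supported ℝ ℝ s) :
    ∃ a ∈ Finsupp.supported ℝ ℝ (s ∩ p), ∃ c ∈ Finsupp.supported ℝ ℝ (s ∩ pᶜ), a + c = z := by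
  rw [← Set.inter_union_compl s p, Finsupp.supported_union, Submodule.mem_sup] at hz
  exact hz

theorem eq_zero_of_add_eq_zero_of_mem_supported {p : Set α} {a c : α →₀ ℝ}
    (ha : a ∈ Finsupp.supported ℝ ℝ p) (hc : c ∈ Finsupp.supported ℝ ℝ pᶜ) (h : a + c = 0) :
    a = 0 ∧ c = 0 := by
  have hd := Finsupp.disjoint_supported_supported (R := ℝ) (M := ℝ)
    (disjoint_compl_right (a := p))
  have h1 : a = 0 := by
    refine Submodule.disjoint_def.1 hd a ha ?_
    rw [eq_neg_of_add_eq_zero_left h]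
    exact Submodule.neg_mem _ hc
  exact ⟨h1, by simpa [h1] using h⟩

theorem sum_sum_eq_zero_of_antisymm {ι : Type*} (U : Finset ι) (A : ι → ι → M)
    (h : ∀ e f, A e f + A f e = 0) : ∑ e ∈ U, ∑ f ∈ U, A e f = 0 := by
  have h1 : ∑ e ∈ U, ∑ f ∈ U, A e f + ∑ e ∈ U, ∑ f ∈ U, A e f = 0 := by
    nth_rewrite 2 [Finset.sum_comm]
    rw [← Finset.sum_add_distrib]
    refine Finset.sum_eq_zero fun e _ => ?_
    rw [← Finset.sum_add_distrib]
    exact Finset.sum_eq_zero fun f _ => h e f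
  rw [← two_smul ℝ] at h1
  exact (smul_eq_zero.1 h1).resolve_left two_ne_zero

end Supported

variable {V : Type u} {E : Type v} {ends : E → Sym2 V} {b : V}

/-- The properties of the signs in the differential which make it square to zero. -/
structure IsSign (σ : EnhancedState ends b → E → ℝ) : Prop where
  ne_zero : ∀ S e, σ S e ≠ 0
  mul_eq : ∀ S e f, e ∉ S.edges → f ∉ S.edges → e ≠ f →
    σ S e * σ (S.insertEdge e) f = -(σ S f * σ (S.insertEdge f) e)

theorem isSign_sign (o : LinearOrder E) :
    IsSign (fun (S : EnhancedState ends b) e => S.sign o e) :=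
  ⟨fun S e => S.sign_ne_zero o e, fun S _ _ he hf hef => S.sign_mul_sign o he hf hef⟩

/-- The part of the differential which adds the edge `e`. -/
noncomputable def edgeDiff (σ : EnhancedState ends b → E → ℝ) (e : E) :
    Cochain ends b →ₗ[ℝ] Cochain ends b :=
  Finsupp.linearCombination ℝ fun S : EnhancedState ends b =>
    if e ∉ S.edges ∧ S.Mergeable e then Finsupp.single (S.insertEdge e) (σ S e) else 0

/-- The part of the differential which adds edges in `U`. -/
noncomputable def diffOn (σ : EnhancedState ends b → E → ℝ) (U : Finset E) :
    Cochain ends b →ₗ[ℝ] Cochain ends b :=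
  ∑ e ∈ U, edgeDiff σ e

variable {σ : EnhancedState ends b → E → ℝ}

theorem edgeDiff_single (e : E) (S : EnhancedState ends b) (c : ℝ) :
    edgeDiff σ e (Finsupp.single S c) = c •
      if e ∉ S.edges ∧ S.Mergeable e then Finsupp.single (S.insertEdge e) (σ S e) else 0 :=
  Finsupp.linearCombination_single ..

theorem edgeDiff_edgeDiff_single (e f : E) (S : EnhancedState ends b) :
    edgeDiff σ f (edgeDiff σ e (Finsupp.single S 1)) =
      if (e ∉ S.edges ∧ f ∉ S.edges ∧ e ≠ f) ∧ (S.Mergeable e ∧ (S.insertEdge e).Mergeable f) then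
        Finsupp.single ((S.insertEdge e).insertEdge f) (σ S e * σ (S.insertEdge e) f) else 0 := by
  rw [edgeDiff_single, one_smul]
  by_cases h : e ∉ S.edges ∧ S.Mergeable e
  · rw [if_pos h, edgeDiff_single]
    have : (f ∉ (S.insertEdge e).edges ∧ (S.insertEdge e).Mergeable f) ↔
        ((e ∉ S.edges ∧ f ∉ S.edges ∧ e ≠ f) ∧ (S.Mergeable e ∧ (S.insertEdge e).Mergeable f)) := by
      rw [EnhancedState.insertEdge_edges, Finset.mem_insert, not_or, ne_comm (a := e)]
      tauto
    simp only [this]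
    split_ifs <;> simp
  · rw [if_neg h, map_zero, if_neg (by tauto)]

/-- Both orders of insertion reach the same state with opposite signs. For `e = f` each summand is
already zero, since the edge is then present. -/
theorem edgeDiff_edgeDiff_add (hσ : IsSign σ) (e f : E) (z : Cochain ends b) :
    edgeDiff σ f (edgeDiff σ e z) + edgeDiff σ e (edgeDiff σ f z) = 0 := by
  have h : (edgeDiff σ f ∘ₗ edgeDiff σ e + edgeDiff σ e ∘ₗ edgeDiff σ f) z =
      (0 : Cochain ends b →ₗ[ℝ] Cochain ends b) z := by
    refine map_eq_of_mem_supported _ _ (s := Set.univ) (fun S _ => ?_) (by simp)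
    simp only [LinearMap.add_apply, LinearMap.comp_apply, LinearMap.zero_apply]
    rw [edgeDiff_edgeDiff_single, edgeDiff_edgeDiff_single]
    by_cases h : (e ∉ S.edges ∧ f ∉ S.edges ∧ e ≠ f) ∧
        (S.Mergeable e ∧ (S.insertEdge e).Mergeable f)
    · rw [if_pos h, if_pos ⟨⟨h.1.2.1, h.1.1, h.1.2.2.symm⟩, (S.mergeable_comm e f).1 h.2⟩,
        S.insertEdge_comm e f, hσ.mul_eq S e f h.1.1 h.1.2.1 h.1.2.2, ← Finsupp.single_add]
      simp
    · rw [if_neg h, if_neg, add_zero]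
      exact fun h' => h ⟨⟨h'.1.2.1, h'.1.1, h'.1.2.2.symm⟩, (S.mergeable_comm e f).2 h'.2⟩
  exact h

theorem diffOn_apply (U : Finset E) (z : Cochain ends b) :
    diffOn σ U z = ∑ e ∈ U, edgeDiff σ e z := by
  simp [diffOn, LinearMap.sum_apply]

theorem diffOn_diffOn (hσ : IsSign σ) (U : Finset E) (z : Cochain ends b) :
    diffOn σ U (diffOn σ U z) = 0 := by
  have h1 : diffOn σ U (diffOn σ U z) = ∑ e ∈ U, ∑ f ∈ U, edgeDiff σ e (edgeDiff σ f z) := by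
    rw [diffOn_apply]
    exact Finset.sum_congr rfl fun e _ => by rw [diffOn_apply, map_sum]
  rw [h1]
  exact sum_sum_eq_zero_of_antisymm U (fun e f => edgeDiff σ e (edgeDiff σ f z))
    fun e f => edgeDiff_edgeDiff_add hσ f e z

theorem diffOn_eq_add {U : Finset E} {e : E} (he : e ∈ U) (z : Cochain ends b) :
    diffOn σ U z = edgeDiff σ e z + diffOn σ (U.erase e) z := by
  rw [diffOn_apply, diffOn_apply]
  exact (Finset.add_sum_erase U (fun e => edgeDiff σ e z) he).symm

theorem differential_eq_diffOn [Fintype E] (o : LinearOrder E) :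
    differential ends o b = diffOn (fun S e => S.sign o e) Finset.univ := by
  refine Finsupp.lhom_ext fun S c => ?_
  rw [diffOn_apply]
  simp only [edgeDiff_single]
  rw [differential, Finsupp.linearCombination_single, ← Finset.smul_sum, Finset.sum_filter]
  congr 1
  refine Finset.sum_congr (by ext; simp) fun e _ => ?_
  simp only [EnhancedState.sign]
  split_ifs <;> first | rfl | tauto

/-- The enhanced states with given number of edges and given degree. -/
def gradedStates (ends : E → Sym2 V) (b : V) (i j : ℤ) : Set (EnhancedState ends b) :=
  {S | (S.edges.card : ℤ) = i ∧ S.degree = j}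

/-- The enhanced states with edge set between `T` and `U` in which the vertices in `B` are
coloured by `x`. -/
def statesBetween (ends : E → Sym2 V) (b : V) (T U : Finset E) (B : Set V) :
    Set (EnhancedState ends b) :=
  {S | T ⊆ S.edges ∧ S.edges ⊆ U ∧ ∀ β ∈ B, S.color β = Color.x}

theorem edgeDiff_mem_supported {s t : Set (EnhancedState ends b)} {e : E}
    (h : ∀ S ∈ s, e ∉ S.edges → S.Mergeable e → S.insertEdge e ∈ t) {z : Cochain ends b}
    (hz : z ∈ Finsupp.supported ℝ ℝ s) : edgeDiff σ e z ∈ Finsupp.supported ℝ ℝ t := by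
  refine map_mem_of_mem_supported _ (fun S hS => ?_) hz
  rw [edgeDiff_single, one_smul]
  split_ifs with h'
  · exact Finsupp.single_mem_supported ℝ _ (h S hS h'.1 h'.2)
  · exact Submodule.zero_mem _

theorem insertEdge_mem_gradedStates {S : EnhancedState ends b} {i j : ℤ} {e : E}
    (he : e ∉ S.edges) (hm : S.Mergeable e) :
    S.insertEdge e ∈ gradedStates ends b i j ↔ S ∈ gradedStates ends b (i - 1) j := by
  simp only [gradedStates, Set.mem_ofPred_eq, S.degree_insertEdge hm,
    EnhancedState.insertEdge_edges, Finset.card_insert_of_notMem he]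
  push_cast
  rw [eq_sub_iff_add_eq]

theorem insertEdge_mem_statesBetween {S : EnhancedState ends b} {T U : Finset E} {B : Set V}
    {e : E} (he : e ∈ U) (hS : S ∈ statesBetween ends b T U B) :
    S.insertEdge e ∈ statesBetween ends b (insert e T) U B :=
  ⟨Finset.insert_subset_insert _ hS.1, Finset.insert_subset he hS.2.1,
    fun β hβ => S.insertEdge_color_of_color e (hS.2.2 β hβ)⟩

theorem statesBetween_mono {T T' U U' : Finset E} {B B' : Set V} (hT : T' ⊆ T) (hU : U ⊆ U')
    (hB : B' ⊆ B) : statesBetween ends b T U B ⊆ statesBetween ends b T' U' B' :=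
  fun _ hS => ⟨hT.trans hS.1, hS.2.1.trans hU, fun β hβ => hS.2.2 β (hB hβ)⟩

theorem edgeDiff_mem_between {T U : Finset E} {B : Set V} {e : E} (he : e ∈ U) {i j : ℤ}
    {z : Cochain ends b}
    (hz : z ∈ Finsupp.supported ℝ ℝ (statesBetween ends b T U B ∩ gradedStates ends b (i - 1) j)) :
    edgeDiff σ e z ∈
      Finsupp.supported ℝ ℝ (statesBetween ends b (insert e T) U B ∩ gradedStates ends b i j) :=
  edgeDiff_mem_supported (fun _ hS h hm => And.intro (insertEdge_mem_statesBetween he hS.1)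
    ((insertEdge_mem_gradedStates h hm).2 hS.2)) hz

theorem diffOn_mem_between {T U : Finset E} {B : Set V} {i j : ℤ}
    {z : Cochain ends b}
    (hz : z ∈ Finsupp.supported ℝ ℝ (statesBetween ends b T U B ∩ gradedStates ends b (i - 1) j)) :
    diffOn σ U z ∈
      Finsupp.supported ℝ ℝ (statesBetween ends b T U B ∩ gradedStates ends b i j) := by
  rw [diffOn_apply]
  exact Submodule.sum_mem _ fun e he => Finsupp.supported_mono (Set.inter_subset_inter_left _
    (statesBetween_mono (Finset.subset_insert e T) subset_rfl subset_rfl))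
    (edgeDiff_mem_between he hz)

theorem edgeDiff_mem_supported_mem (e : E) (z : Cochain ends b) :
    edgeDiff σ e z ∈ Finsupp.supported ℝ ℝ {S : EnhancedState ends b | e ∈ S.edges} :=
  edgeDiff_mem_supported (s := Set.univ) (fun S _ _ _ => by simp) (by simp)

theorem diffOn_erase_mem_supported_notMem (U : Finset E) (e : E) {z : Cochain ends b}
    (hz : z ∈ Finsupp.supported ℝ ℝ {S : EnhancedState ends b | e ∈ S.edges}ᶜ) :
    diffOn σ (U.erase e) z ∈ Finsupp.supported ℝ ℝ {S : EnhancedState ends b | e ∈ S.edges}ᶜ := by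
  rw [diffOn_apply]
  refine Submodule.sum_mem _ fun f hf => edgeDiff_mem_supported (fun S hS _ _ => ?_) hz
  have hS : e ∉ S.edges := hS
  have hef : e ≠ f := (Finset.ne_of_mem_erase hf).symm
  simp [hS, hef]

theorem mem_statesBetween_erase {T U : Finset E} {B : Set V} {e : E} {S : EnhancedState ends b}
    (hS : S ∈ statesBetween ends b T U B) (he : e ∉ S.edges) :
    S ∈ statesBetween ends b T (U.erase e) B :=
  ⟨hS.1, Finset.subset_erase.2 ⟨hS.2.1, he⟩, hS.2.2⟩

/-- If toggling the edge `e` is a bijection between the states without `e` which satisfy `P` and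
the states with `e`, then a cocycle is cohomologous to a combination of states without `e` which
do not satisfy `P`. -/
theorem exists_sub_diffOn_mem_of_toggle (hσ : IsSign σ) {T U : Finset E} {B : Set V} {e : E}
    (heU : e ∈ U) (P : EnhancedState ends b → Prop) (g : EnhancedState ends b → EnhancedState ends b)
    (hm : ∀ S ∈ statesBetween ends b T U B, e ∉ S.edges → P S →
      S.Mergeable e ∧ g (S.insertEdge e) = S)
    (hg : ∀ R ∈ statesBetween ends b T U B, e ∈ R.edges →
      (g R) ∈ statesBetween ends b T U B ∧ e ∉ (g R).edges ∧ (g R).Mergeable e ∧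
        (g R).insertEdge e = R)
    (hn : ∀ S ∈ statesBetween ends b T U B, e ∉ S.edges → ¬ P S → ¬ S.Mergeable e)
    {i j : ℤ} {z : Cochain ends b}
    (hz : z ∈ Finsupp.supported ℝ ℝ (statesBetween ends b T U B ∩ gradedStates ends b i j))
    (hd : diffOn σ U z = 0) :
    ∃ y ∈ Finsupp.supported ℝ ℝ (statesBetween ends b T U B ∩ gradedStates ends b (i - 1) j),
      z - diffOn σ U y ∈ Finsupp.supported ℝ ℝ
        (statesBetween ends b T (U.erase e) B ∩ gradedStates ends b i j ∩ {S | ¬ P S}) := by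
  -- `G` deletes `e` and divides by the sign: it is a right inverse of `edgeDiff σ e` on states with
  -- `e`, and a left inverse on states without `e` satisfying `P`.
  let G : Cochain ends b →ₗ[ℝ] Cochain ends b := Finsupp.linearCombination ℝ fun R =>
    if e ∈ R.edges then Finsupp.single (g R) (σ (g R) e)⁻¹ else 0
  have hG : ∀ R, G (Finsupp.single R 1) =
      if e ∈ R.edges then Finsupp.single (g R) (σ (g R) e)⁻¹ else 0 := fun R => by
    simp [G, Finsupp.linearCombination_single]
  obtain ⟨a, ha, c, hc, rfl⟩ := exists_add_of_mem_supported {S | e ∈ S.edges} hz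
  have hGc : G c = 0 := map_eq_of_mem_supported G 0 (fun S hS => by
    rw [hG, if_neg (show e ∉ S.edges from hS.2), LinearMap.zero_apply]) hc
  have hGa : edgeDiff σ e (G a) = a :=
    map_eq_of_mem_supported (edgeDiff σ e ∘ₗ G) LinearMap.id (fun R hR => by
      obtain ⟨-, h1, h2, h3⟩ := hg R hR.1.1 hR.2
      rw [LinearMap.comp_apply, hG, if_pos (show e ∈ R.edges from hR.2), edgeDiff_single, if_pos ⟨h1, h2⟩, h3,
        Finsupp.smul_single, smul_eq_mul, inv_mul_cancel₀ (hσ.ne_zero _ _), LinearMap.id_apply]) ha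
  have hGm : G a ∈ Finsupp.supported ℝ ℝ
      ((statesBetween ends b T U B ∩ gradedStates ends b (i - 1) j) ∩ {S | e ∈ S.edges}ᶜ) :=
    map_mem_of_mem_supported G (fun R hR => by
      obtain ⟨h0, h1, h2, h3⟩ := hg R hR.1.1 hR.2
      rw [hG, if_pos (show e ∈ R.edges from hR.2)]
      refine Finsupp.single_mem_supported ℝ _ ⟨⟨h0, ?_⟩, h1⟩
      rw [← insertEdge_mem_gradedStates h1 h2, h3]
      exact hR.1.2) ha
  have hGm' := Finsupp.supported_mono Set.inter_subset_left hGm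
  have hGe := Finsupp.supported_mono Set.inter_subset_right hGm
  -- Subtracting the coboundary of `G a` cancels `a`, the part of the cocycle on states containing
  -- `e`.
  refine ⟨G a, hGm', ?_⟩
  have hz1 : a + c - diffOn σ U (G a) = c - diffOn σ (U.erase e) (G a) := by
    rw [diffOn_eq_add heU, hGa]
    abel
  have hz2 : c - diffOn σ (U.erase e) (G a) ∈
      Finsupp.supported ℝ ℝ {S : EnhancedState ends b | e ∈ S.edges}ᶜ :=
    Submodule.sub_mem _ (Finsupp.supported_mono Set.inter_subset_right hc)
      (diffOn_erase_mem_supported_notMem U e hGe)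
  have hz3 : a + c - diffOn σ U (G a) ∈
      Finsupp.supported ℝ ℝ (statesBetween ends b T U B ∩ gradedStates ends b i j) :=
    Submodule.sub_mem _ hz (diffOn_mem_between hGm')
  rw [← hz1] at hz2
  have hz4 : diffOn σ U (a + c - diffOn σ U (G a)) = 0 := by
    rw [map_sub, hd, diffOn_diffOn hσ, sub_zero]
  set z' := a + c - diffOn σ U (G a) with hz'
  have hz5 : z' ∈ Finsupp.supported ℝ ℝ
      (statesBetween ends b T (U.erase e) B ∩ gradedStates ends b i j) := by
    have : z' ∈ Finsupp.supported ℝ ℝ ((statesBetween ends b T U B ∩ gradedStates ends b i j) ∩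
        {S | e ∈ S.edges}ᶜ) := by
      rw [Finsupp.supported_inter]
      exact ⟨hz3, hz2⟩
    exact Finsupp.supported_mono (fun S hS =>
      And.intro (mem_statesBetween_erase hS.1.1 hS.2) hS.1.2) this
  rw [diffOn_eq_add heU] at hz4
  -- As `z'` involves no state with `e`, the terms of its differential that contain `e` are exactly
  -- `edgeDiff σ e z'`, so these vanish on their own.
  have hz6 := (eq_zero_of_add_eq_zero_of_mem_supported (edgeDiff_mem_supported_mem e z')
    (diffOn_erase_mem_supported_notMem U e hz2) hz4).1
  obtain ⟨p, hp, q, hq, hpq⟩ := exists_add_of_mem_supported {S | P S} hz5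
  have hne : ∀ {S}, S ∈ statesBetween ends b T (U.erase e) B →
      S ∈ statesBetween ends b T U B ∧ e ∉ S.edges := fun hS =>
    ⟨statesBetween_mono subset_rfl (Finset.erase_subset _ _) subset_rfl hS,
      (Finset.subset_erase.1 hS.2.1).2⟩
  have hq0 : edgeDiff σ e q = 0 := map_eq_of_mem_supported _ 0 (fun S hS => by
    obtain ⟨h1, h2⟩ := hne hS.1.1
    rw [edgeDiff_single, if_neg fun h => hn S h1 h2 hS.2 h.2, smul_zero,
      LinearMap.zero_apply]) hq
  have hp0 : G (edgeDiff σ e p) = p :=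
    map_eq_of_mem_supported (G ∘ₗ edgeDiff σ e) LinearMap.id (fun S hS => by
      obtain ⟨h1, h2⟩ := hne hS.1.1
      obtain ⟨h3, h4⟩ := hm S h1 h2 hS.2
      rw [LinearMap.comp_apply, edgeDiff_single, if_pos ⟨h2, h3⟩, one_smul,
        ← mul_one (σ S e), ← smul_eq_mul, ← Finsupp.smul_single, map_smul, hG,
        if_pos (by simp), h4, Finsupp.smul_single, smul_eq_mul,
        mul_inv_cancel₀ (hσ.ne_zero _ _), LinearMap.id_apply]) hp
  -- Adding `e` kills the part `q` violating `P` and is injective on the part `p` satisfying it.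
  have : p = 0 := by
    rw [← hpq, map_add, hq0, add_zero] at hz6
    rw [← hp0, hz6, map_zero]
  rw [← hpq, this, zero_add]
  exact hq

end ReducedChromatic

/-! ### Thinness by deletion and contraction. -/

namespace ReducedChromatic

universe u v

open scoped Classical

variable {V : Type u} {E : Type v} {ends : E → Sym2 V} {b : V}
  {σ : EnhancedState ends b → E → ℝ}

/-- The complex of the states between `T` and `U` in which `B` is coloured by `x` is exact outside
the bidegrees `(i, j)` with `i + j = r`. -/
def IsThin (σ : EnhancedState ends b → E → ℝ) (T U : Finset E) (B : Set V) (r : ℤ) : Prop :=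
  ∀ i j : ℤ, i + j ≠ r → ∀ z ∈ Finsupp.supported ℝ ℝ
    (statesBetween ends b T U B ∩ gradedStates ends b i j), diffOn σ U z = 0 →
    ∃ y ∈ Finsupp.supported ℝ ℝ (statesBetween ends b T U B ∩ gradedStates ends b (i - 1) j),
      diffOn σ U y = z

/-- The state obtained by deleting an edge `e` and keeping the colours of the vertices. -/
noncomputable def EnhancedState.eraseEdge (R : EnhancedState ends b) (e : E) : EnhancedState ends b where
  edges := R.edges.erase e
  color := R.color
  color_eq v w h := R.color_eq v w (reachable_mono (Finset.erase_subset _ _) h)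
  color_base := R.color_base

/-- Modulo `T` the edge `e` is a loop: adding it changes neither components nor colours, so toggling
`e` pairs off all states. The complex is exact in every bidegree, hence `r` is arbitrary. -/
theorem isThin_of_reachable (hσ : IsSign σ) {T U : Finset E} {B : Set V} {e : E} (heU : e ∈ U)
    (heT : e ∉ T) {v w : V} (he : ends e = s(v, w)) (hr : (stateGraph ends T).Reachable v w)
    (r : ℤ) : IsThin σ T U B r := by
  intro i j _ z hz hd
  have hadd : ∀ s : Finset E, T ⊆ s → ∀ a c, (stateGraph ends (insert e s)).Reachable a c ↔
      (stateGraph ends s).Reachable a c := fun s hs a c =>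
    reachable_insert_iff_of_reachable he (reachable_mono hs hr)
  have hcol : ∀ S : EnhancedState ends b, T ⊆ S.edges → (S.insertEdge e).color = S.color := by
    refine fun S hS => funext fun a => Color.eq_of_iff ?_
    rw [S.insertEdge_color_eq_x_iff]
    refine ⟨fun ⟨c, hc, hx⟩ => ?_, fun h => ⟨a, .refl _, h⟩⟩
    rw [S.color_eq _ _ ((hadd _ hS _ _).1 hc), hx]
  obtain ⟨y, hy, hyz⟩ := exists_sub_diffOn_mem_of_toggle hσ heU (fun _ => True)
    (fun R => R.eraseEdge e) (fun S hS heS _ => ⟨fun a c h _ _ => (hadd _ hS.1 _ _).1 h,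
      EnhancedState.ext (Finset.erase_insert heS) (hcol S hS.1)⟩)
    (fun R hR heR => by
      have hT : T ⊆ (R.eraseEdge e).edges :=
        Finset.subset_erase.2 ⟨hR.1, heT⟩
      exact ⟨⟨hT, (Finset.erase_subset _ _).trans hR.2.1, hR.2.2⟩, Finset.notMem_erase _ _,
        fun a c h _ _ => (hadd _ hT _ _).1 h,
        EnhancedState.ext (Finset.insert_erase heR) (hcol (R.eraseEdge e) hT)⟩)
    (fun S _ _ h => absurd trivial h) hz hd
  refine ⟨y, hy, ?_⟩
  have h0 : z - diffOn σ U y ∈ Finsupp.supported ℝ ℝ (∅ : Set (EnhancedState ends b)) :=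
    Finsupp.supported_mono (fun S hS => absurd trivial hS.2) hyz
  rw [Finsupp.supported_empty, Submodule.mem_bot, sub_eq_zero] at h0
  exact h0.symm

/-- The states containing `e` span a subcomplex (contraction of `e`) whose quotient is spanned by
the states without `e` (deletion of `e`). Exactness passes from both to the middle term; the diagram
chase is done on representatives. -/
theorem isThin_of_erase_of_insert (hσ : IsSign σ) {T U : Finset E} {B : Set V} {e : E}
    (heU : e ∈ U) {r : ℤ} (h1 : IsThin σ T (U.erase e) B r)
    (h2 : IsThin σ (insert e T) U B r) : IsThin σ T U B r := by
  intro i j hij z hz hd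
  have hT : ∀ k, Finsupp.supported ℝ ℝ
      (statesBetween ends b (insert e T) U B ∩ gradedStates ends b k j) ≤
      Finsupp.supported ℝ ℝ (statesBetween ends b T U B ∩ gradedStates ends b k j) := fun k =>
    Finsupp.supported_mono (Set.inter_subset_inter_left _
      (statesBetween_mono (Finset.subset_insert e T) subset_rfl subset_rfl))
  have hU : ∀ k, Finsupp.supported ℝ ℝ
      (statesBetween ends b T (U.erase e) B ∩ gradedStates ends b k j) ≤
      Finsupp.supported ℝ ℝ (statesBetween ends b T U B ∩ gradedStates ends b k j) := fun k =>
    Finsupp.supported_mono (Set.inter_subset_inter_left _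
      (statesBetween_mono subset_rfl (Finset.erase_subset _ _) subset_rfl))
  obtain ⟨a, ha, c, hc, rfl⟩ := exists_add_of_mem_supported {S | e ∈ S.edges} hz
  have hce := Finsupp.supported_mono Set.inter_subset_right hc
  have hc' : c ∈ Finsupp.supported ℝ ℝ
      (statesBetween ends b T (U.erase e) B ∩ gradedStates ends b i j) :=
    Finsupp.supported_mono (fun S hS => And.intro (mem_statesBetween_erase hS.1.1 hS.2) hS.1.2) hc
  have ha' : a ∈ Finsupp.supported ℝ ℝ
      (statesBetween ends b (insert e T) U B ∩ gradedStates ends b i j) :=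
    Finsupp.supported_mono (fun S hS => And.intro
      ⟨Finset.insert_subset hS.2 hS.1.1.1, hS.1.1.2⟩ hS.1.2) ha
  have hmem : ∀ z, z ∈ Finsupp.supported ℝ ℝ
      (statesBetween ends b (insert e T) U B ∩ gradedStates ends b i j) → diffOn σ U z ∈
      Finsupp.supported ℝ ℝ {S : EnhancedState ends b | e ∈ S.edges} := fun z hz => by
    have hz' : z ∈ Finsupp.supported ℝ ℝ (statesBetween ends b (insert e T) U B ∩
        gradedStates ends b (i + 1 - 1) j) := by
      rw [add_sub_cancel_right]
      exact hz
    exact Finsupp.supported_mono (fun S hS => hS.1.1 (Finset.mem_insert_self e T))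
      (diffOn_mem_between hz')
  -- The terms without `e` in the differential of `a + c` come only from `c`, so `c` is a cocycle of
  -- the quotient.
  have hdc : diffOn σ (U.erase e) c = 0 := by
    refine (eq_zero_of_add_eq_zero_of_mem_supported
      (Submodule.add_mem _ (hmem a ha') (edgeDiff_mem_supported_mem (σ := σ) e c))
      (diffOn_erase_mem_supported_notMem U e hce) ?_).2
    rw [add_assoc, ← diffOn_eq_add heU, ← map_add, hd]
  obtain ⟨y, hy, rfl⟩ := h1 i j hij c hc' hdc
  have hay : a - edgeDiff σ e y ∈ Finsupp.supported ℝ ℝ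
      (statesBetween ends b (insert e T) U B ∩ gradedStates ends b i j) :=
    Submodule.sub_mem _ ha' (edgeDiff_mem_between heU (hU _ hy))
  have hay' : a - edgeDiff σ e y = a + diffOn σ (U.erase e) y - diffOn σ U y := by
    rw [diffOn_eq_add heU]
    abel
  obtain ⟨x, hx, hxa⟩ := h2 i j hij _ hay (by
    rw [hay', map_sub, hd, diffOn_diffOn hσ, sub_zero])
  refine ⟨x + y, Submodule.add_mem _ (hT _ hx) (hU _ hy), ?_⟩
  rw [map_add, hxa, hay', sub_add_cancel]

/-- The state obtained by deleting an edge `e` and giving the colour `1` to the component of the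
vertex `w`. -/
noncomputable def EnhancedState.eraseBridge (R : EnhancedState ends b) (e : E) (w : V)
    (hw : ¬ (stateGraph ends (R.edges.erase e)).Reachable b w) : EnhancedState ends b where
  edges := R.edges.erase e
  color a := if (stateGraph ends (R.edges.erase e)).Reachable a w then Color.one else R.color a
  color_eq a c h := by
    have h1 : (stateGraph ends (R.edges.erase e)).Reachable a w ↔
        (stateGraph ends (R.edges.erase e)).Reachable c w :=
      ⟨fun h' => h.symm.trans h', fun h' => h.trans h'⟩
    simp only [h1, R.color_eq a c (reachable_mono (Finset.erase_subset _ _) h)]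
  color_base := by rw [if_neg hw, R.color_base]

/-- The end `v` always has colour x. States without `e` in which `w` has colour 1 therefore pair off
with the states containing `e`, while for `w` of colour x adding `e` gives x·x = 0. What remains is
the complex with `e` deleted and `w` added to `B`. -/
theorem isThin_of_bridge (hσ : IsSign σ) {T U : Finset E} {B : Set V} {e : E} (heU : e ∈ U)
    (heT : e ∉ T) {v w β : V} (he : ends e = s(v, w)) (hb : b ∈ B) (hβ : β ∈ B)
    (hv : (stateGraph ends T).Reachable v β)
    (hvw : ¬ (stateGraph ends (U.erase e)).Reachable v w)
    (hB : ∀ β ∈ B, ∀ β' ∈ B, (stateGraph ends U).Reachable β β' → β = β') {r : ℤ}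
    (h : IsThin σ T (U.erase e) (insert w B) r) : IsThin σ T U B r := by
  intro i j hij z hz hd
  have hTU : ∀ {S : EnhancedState ends b}, S ∈ statesBetween ends b T U B → T ⊆ U :=
    fun hS => hS.1.trans hS.2.1
  have hvx : ∀ {S : EnhancedState ends b}, S ∈ statesBetween ends b T U B →
      S.color v = Color.x := fun {S} hS => by
    rw [S.color_eq _ _ (reachable_mono hS.1 hv), hS.2.2 β hβ]
  have hsub : ∀ {S : EnhancedState ends b}, S ∈ statesBetween ends b T U B → e ∉ S.edges →
      ¬ (stateGraph ends S.edges).Reachable v w := fun {S} hS heS hr =>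
    hvw (reachable_mono (Finset.subset_erase.2 ⟨hS.2.1, heS⟩) hr)
  -- A point of `B` joined to `w` without `e` would have to be `β`, and then `v` and `w` would be
  -- joined without `e`. Hence recolouring the component of `w` by 1 affects neither `B` nor the
  -- base point.
  have hBw : T ⊆ U → ∀ {s : Finset E}, s ⊆ U.erase e → ∀ β' ∈ B,
      ¬ (stateGraph ends s).Reachable β' w := by
    intro hTU s hs β' hβ' hr
    have hTe : T ⊆ U.erase e := Finset.subset_erase.2 ⟨hTU, heT⟩
    have hr' := reachable_mono hs hr
    have h1 : (stateGraph ends U).Reachable β' β :=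
      ((reachable_mono (Finset.erase_subset _ _) hr').trans (reachable_of_mem heU he).symm).trans
        (reachable_mono hTU hv)
    have h2 := hB β' hβ' β hβ h1
    subst h2
    exact hvw ((reachable_mono hTe hv).trans hr')
  have hmerge : ∀ S ∈ statesBetween ends b T U B, S.color w = Color.one → S.Mergeable e := by
    intro S hS hw a c hr ha hc
    rw [reachable_insert_iff he] at hr
    rcases hr with hr | hr | hr
    · exact hr
    · rw [← S.color_eq _ _ hr.2, hw] at hc
      cases hc
    · rw [S.color_eq _ _ hr.1, hw] at ha
      cases ha
  -- The value `R` in the first branch is a dummy: `hBw` excludes that branch for every state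
  -- considered.
  let g : EnhancedState ends b → EnhancedState ends b := fun R =>
    if hw : (stateGraph ends (R.edges.erase e)).Reachable b w then R else R.eraseBridge e w hw
  have hgR : ∀ {R : EnhancedState ends b}, R ∈ statesBetween ends b T U B →
      (g R).edges = R.edges.erase e ∧ ∀ a, (g R).color a =
        if (stateGraph ends (R.edges.erase e)).Reachable a w then Color.one else R.color a := by
    intro R hR
    have hw := hBw (hTU hR) (Finset.erase_subset_erase e hR.2.1) b hb
    simp only [g]
    rw [dif_neg hw]
    exact ⟨rfl, fun _ => rfl⟩
  obtain ⟨y, hy, hyz⟩ := exists_sub_diffOn_mem_of_toggle hσ heU (fun S => S.color w = Color.one) g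
    (fun S hS heS hw => by
      refine ⟨hmerge S hS hw, ?_⟩
      obtain ⟨h1, h2⟩ := hgR (statesBetween_mono (Finset.subset_insert e T) subset_rfl subset_rfl
        (insertEdge_mem_statesBetween heU hS))
      rw [EnhancedState.insertEdge_edges, Finset.erase_insert heS] at h1 h2
      refine EnhancedState.ext h1 (funext fun a => ?_)
      rw [h2]
      split_ifs with ha
      · rw [S.color_eq _ _ ha, hw]
      · refine Color.eq_of_iff ?_
        rw [S.insertEdge_color_eq_x_iff]
        refine ⟨fun ⟨c, hc, hx⟩ => ?_, fun h => ⟨a, .refl _, h⟩⟩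
        rw [reachable_insert_iff he] at hc
        rcases hc with hr | hr | hr
        · rw [S.color_eq _ _ hr, hx]
        · rw [← S.color_eq _ _ hr.2, hw] at hx
          cases hx
        · exact absurd hr.1 ha)
    (fun R hR heR => by
      obtain ⟨h1, h2⟩ := hgR hR
      have hsU := Finset.erase_subset_erase e hR.2.1
      have hgm : g R ∈ statesBetween ends b T U B := by
        refine ⟨?_, ?_, fun β' hβ' => ?_⟩
        · rw [h1]
          exact Finset.subset_erase.2 ⟨hR.1, heT⟩
        · rw [h1]
          exact (Finset.erase_subset _ _).trans hR.2.1
        · rw [h2, if_neg (hBw (hTU hR) hsU β' hβ'), hR.2.2 β' hβ']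
      have hgw : (g R).color w = Color.one := by rw [h2, if_pos (.refl _)]
      have hge : (insert e (g R).edges) = R.edges := by rw [h1, Finset.insert_erase heR]
      refine ⟨hgm, by simp [h1], hmerge _ hgm hgw, EnhancedState.ext hge
        (funext fun a => Color.eq_of_iff ?_)⟩
      rw [EnhancedState.insertEdge_color_eq_x_iff, hge]
      constructor
      · rintro ⟨c, hc, hx⟩
        rw [h2] at hx
        split_ifs at hx
        rw [R.color_eq _ _ hc, hx]
      · intro ha
        by_cases haw : (stateGraph ends (R.edges.erase e)).Reachable a w
        · refine ⟨v, ?_, ?_⟩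
          · exact (reachable_mono (Finset.erase_subset _ _) haw).trans
              (reachable_of_mem heR he).symm
          · rw [h2, if_neg fun hr => hvw (reachable_mono hsU hr), hvx hR]
        · exact ⟨a, .refl _, by rw [h2, if_neg haw, ha]⟩)
    (fun S hS heS hw hm => hsub hS heS (hm v w
      (reachable_of_mem (Finset.mem_insert_self _ _) he) (hvx hS)
      (by by_contra hx; exact hw (Color.eq_one_of_ne hx)))) hz hd
  have hxw : ∀ {S : EnhancedState ends b}, ¬ S.color w = Color.one → S.color w = Color.x := by
    intro S hS
    by_contra hx
    exact hS (Color.eq_one_of_ne hx)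
  have hyz' : z - diffOn σ U y ∈ Finsupp.supported ℝ ℝ
      (statesBetween ends b T (U.erase e) (insert w B) ∩ gradedStates ends b i j) := by
    refine Finsupp.supported_mono (fun S hS => And.intro ⟨hS.1.1.1, hS.1.1.2.1, ?_⟩ hS.1.2) hyz
    rintro β' (rfl | hβ')
    · exact hxw hS.2
    · exact hS.1.1.2.2 β' hβ'
  -- On the remaining states both ends of `e` have colour x in different components, so the term for
  -- `e` vanishes and the two differentials agree.
  have hker : ∀ {k : ℤ} {x}, x ∈ Finsupp.supported ℝ ℝ
      (statesBetween ends b T (U.erase e) (insert w B) ∩ gradedStates ends b k j) →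
      diffOn σ U x = diffOn σ (U.erase e) x := by
    intro k x hx
    rw [diffOn_eq_add heU]
    have : edgeDiff σ e x = 0 := map_eq_of_mem_supported _ 0 (fun S hS => by
      have heS : e ∉ S.edges := (Finset.subset_erase.1 hS.1.2.1).2
      have hSU : S ∈ statesBetween ends b T U B :=
        statesBetween_mono subset_rfl (Finset.erase_subset _ _) (Set.subset_insert _ _) hS.1
      rw [edgeDiff_single, if_neg, smul_zero, LinearMap.zero_apply]
      exact fun hm => hsub hSU heS (hm.2 v w (reachable_of_mem (Finset.mem_insert_self _ _) he)
        (hvx hSU) (hS.1.2.2 w (Set.mem_insert _ _)))) hx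
    rw [this, zero_add]
  obtain ⟨x, hx, hxz⟩ := h i j hij _ hyz' (by
    rw [← hker hyz', map_sub, hd, diffOn_diffOn hσ, sub_zero])
  refine ⟨x + y, Submodule.add_mem _ (Finsupp.supported_mono (Set.inter_subset_inter_left _
    (statesBetween_mono subset_rfl (Finset.erase_subset _ _) (Set.subset_insert _ _))) hx) hy, ?_⟩
  rw [map_add, hker hx, hxz, sub_add_cancel]

theorem degree_of_forall_color_eq_x (S : EnhancedState ends b) (h : ∀ v, S.color v = Color.x) :
    S.degree = numComponents ends S.edges - 1 := by
  unfold EnhancedState.degree numComponents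
  rw [← Set.ncard_univ]
  congr 3
  refine Set.eq_univ_of_forall fun K => ?_
  induction K using SimpleGraph.ConnectedComponent.ind with | _ v
  exact ⟨v, rfl, h v⟩

/-- At most one state is left, with edge set `T` and all components coloured x; it lies on the
stated diagonal. -/
theorem isThin_refl {T : Finset E} {B : Set V}
    (hB : ∀ v, ∃ β ∈ B, (stateGraph ends T).Reachable v β) :
    IsThin σ T T B (T.card + numComponents ends T - 1) := by
  intro i j hij z hz _
  have h0 : z ∈ Finsupp.supported ℝ ℝ (∅ : Set (EnhancedState ends b)) := by
    refine Finsupp.supported_mono ?_ hz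
    rintro S ⟨⟨h1, h2, h3⟩, h4, h5⟩
    have hST : S.edges = T := h2.antisymm h1
    refine hij ?_
    rw [← h4, ← h5, degree_of_forall_color_eq_x S, hST]
    · ring
    · intro v
      obtain ⟨β, hβ, hr⟩ := hB v
      rw [S.color_eq v β (by rw [hST]; exact hr), h3 β hβ]
  rw [Finsupp.supported_empty, Submodule.mem_bot] at h0
  exact ⟨0, Submodule.zero_mem _, by rw [h0, map_zero]⟩

/-- An edge set `U` which is larger than `T` and joins different components of `T` only contains
an edge outside `T` which leaves the component of a given base vertex. -/
theorem exists_edge_leaving [Finite V] {T U : Finset E} {B : Set V} (hTU : T ⊂ U)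
    (hB : ∀ v, ∃ β ∈ B, (stateGraph ends U).Reachable v β)
    (hl : ∀ e ∈ U, e ∉ T → ∀ v w, ends e = s(v, w) → ¬ (stateGraph ends T).Reachable v w) :
    ∃ e ∈ U, e ∉ T ∧ ∃ β ∈ B, ∃ v w, ends e = s(v, w) ∧ (stateGraph ends T).Reachable v β := by
  obtain ⟨f, hfU, hfT⟩ := Finset.exists_of_ssubset hTU
  obtain ⟨⟨a, c⟩, hac⟩ := (Sym2.mk_surjective (α := V)) (ends f)
  obtain ⟨β, hβ, hr⟩ := hB a
  -- Otherwise the `T`-component of `β` is closed under all edges of `U`, so it contains both ends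
  -- of `f`, against `hl`.
  by_contra! hcon
  have hstep : ∀ g ∈ U, ∀ p q, ends g = s(p, q) → (stateGraph ends T).Reachable p β →
      (stateGraph ends T).Reachable q β := fun g hg p q hpq hp => by
    by_cases hgT : g ∈ T
    · exact (reachable_of_mem hgT hpq).symm.trans hp
    · exact absurd hp (hcon g hg hgT β hβ p q hpq)
  have ha := Reachable.induct (P := fun x => (stateGraph ends T).Reachable x β) hstep hr.symm
    (.refl _)
  have hc := hstep f hfU a c hac.symm ha
  exact hl f hfU hfT a c hac.symm (ha.trans hc.symm)

/-- `B` varies in the induction because deleting a bridge creates a component of `U` that needs its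
own marked vertex. -/
theorem isThin_of_components [Finite V] (hσ : IsSign σ) (n : ℕ) : ∀ (T U : Finset E) (B : Set V),
    (U \ T).card = n → T ⊆ U → b ∈ B → (∀ v, ∃ β ∈ B, (stateGraph ends U).Reachable v β) →
    (∀ β ∈ B, ∀ β' ∈ B, (stateGraph ends U).Reachable β β' → β = β') →
    IsThin σ T U B (T.card + numComponents ends T - 1) := by
  induction n with
  | zero =>
    intro T U B hn hTU _ hB _
    have : U = T := (Finset.sdiff_eq_empty_iff_subset.1 (Finset.card_eq_zero.1 hn)).antisymm hTU
    subst this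
    exact isThin_refl hB
  | succ n ih =>
    intro T U B hn hTU hb hB hB'
    by_cases hl : ∀ e ∈ U, e ∉ T → ∀ v w, ends e = s(v, w) →
        ¬ (stateGraph ends T).Reachable v w
    swap
    · push Not at hl
      obtain ⟨e, heU, heT, v, w, he, hr⟩ := hl
      exact isThin_of_reachable hσ heU heT he hr _
    have hne : T ⊂ U := hTU.ssubset_of_ne (by rintro rfl; simp at hn)
    -- The edge is chosen at the `T`-component of a marked vertex so that, if it is a bridge, one
    -- end is known to have colour x.
    obtain ⟨e, heU, heT, β, hβ, v, w, he, hv⟩ := exists_edge_leaving hne hB hl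
    have hTe : T ⊆ U.erase e := Finset.subset_erase.2 ⟨hTU, heT⟩
    have hcard : (U.erase e \ T).card = n := by
      rw [Finset.erase_sdiff_comm, Finset.card_erase_of_mem (Finset.mem_sdiff.2 ⟨heU, heT⟩), hn,
        Nat.add_sub_cancel]
    have hins : insert e (U.erase e) = U := Finset.insert_erase heU
    by_cases hvw : (stateGraph ends (U.erase e)).Reachable v w
    · have hiff : ∀ {a c}, (stateGraph ends U).Reachable a c ↔
          (stateGraph ends (U.erase e)).Reachable a c := fun {a c} => by
        rw [← reachable_insert_iff_of_reachable he hvw, hins]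
      refine isThin_of_erase_of_insert hσ heU
        (ih T (U.erase e) B hcard hTe hb (by simpa only [hiff] using hB)
          (by simpa only [hiff] using hB')) ?_
      have h := ih (insert e T) U B (by
        rw [Finset.sdiff_insert, Finset.card_erase_of_mem (Finset.mem_sdiff.2 ⟨heU, heT⟩), hn,
          Nat.add_sub_cancel]) (Finset.insert_subset heU hTU) hb hB hB'
      rw [Finset.card_insert_of_notMem heT] at h
      -- Contracting `e` adds one edge to `T` and removes one component, so the diagonal is
      -- unchanged.
      rw [← numComponents_insert he (hl e heU heT v w he)]
      convert h using 1
      push_cast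
      ring
    · refine isThin_of_bridge hσ heU heT he hb hβ hv hvw hB'
        (ih T (U.erase e) (insert w B) hcard hTe (Set.mem_insert_of_mem _ hb) ?_ ?_)
      · intro a
        obtain ⟨γ, hγ, hr⟩ := hB a
        rw [← hins, reachable_insert_iff he] at hr
        rcases hr with hr | hr | hr
        · exact ⟨γ, Set.mem_insert_of_mem _ hγ, hr⟩
        · exact ⟨β, Set.mem_insert_of_mem _ hβ, hr.1.trans (reachable_mono hTe hv)⟩
        · exact ⟨w, Set.mem_insert _ _, hr.1⟩
      · have hw : ∀ γ ∈ B, ¬ (stateGraph ends (U.erase e)).Reachable w γ := by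
          intro γ hγ hr
          have h1 : (stateGraph ends U).Reachable β γ :=
            ((reachable_mono hTU hv).symm.trans (reachable_of_mem heU he)).trans
              (reachable_mono (Finset.erase_subset _ _) hr)
          have h2 := hB' β hβ γ hγ h1
          subst h2
          exact hvw ((reachable_mono hTe hv).trans hr.symm)
        rintro γ (rfl | hγ) γ' (rfl | hγ') hr
        · rfl
        · exact absurd hr (hw γ' hγ')
        · exact absurd hr.symm (hw γ hγ)
        · exact hB' γ hγ γ' hγ' (reachable_mono (Finset.erase_subset _ _) hr)

/-- The reduced chromatic complex of a connected graph is exact off one diagonal. -/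
theorem isThin_univ [Finite V] [Fintype E] (hσ : IsSign σ)
    (hconn : (stateGraph ends Finset.univ).Connected) :
    IsThin σ ∅ Finset.univ {b} (numComponents ends ∅ - 1) := by
  have h := isThin_of_components hσ _ ∅ Finset.univ {b} rfl (Finset.empty_subset _)
    (Set.mem_singleton b) (fun v => ⟨b, rfl, hconn.preconnected v b⟩)
    (by rintro _ rfl _ rfl _; rfl)
  simpa using h

end ReducedChromatic

/-! ### Dimensions and the Euler characteristic of the reduced complex. -/

namespace ReducedChromatic

universe u v

open scoped Classical

variable {V : Type u} {E : Type v} {ends : E → Sym2 V} {b : V}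

theorem cochainGroup_eq_bot {i j : ℤ} (h : gradedStates ends b i j = ∅) :
    cochainGroup ends b i j = ⊥ := by
  have : cochainGroup ends b i j = Finsupp.supported ℝ ℝ (gradedStates ends b i j) := rfl
  rw [this, h, Finsupp.supported_empty]

theorem gradedStates_eq_empty_of_neg_left {i j : ℤ} (hi : i < 0) :
    gradedStates ends b i j = ∅ :=
  Set.eq_empty_of_forall_notMem fun S hS => by
    have := hS.1
    omega

theorem gradedStates_eq_empty_of_neg_right [Finite V] {i j : ℤ} (hj : j < 0) :
    gradedStates ends b i j = ∅ :=
  Set.eq_empty_of_forall_notMem fun S hS => by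
    have := hS.2
    have := S.degree_nonneg
    omega

section Dimension

variable [Finite E]

theorem differential_mem_cochainGroup (o : LinearOrder E) {i j : ℤ} {z : Cochain ends b}
    (hz : z ∈ cochainGroup ends b (i - 1) j) :
    differential ends o b z ∈ cochainGroup ends b i j := by
  have := Fintype.ofFinite E
  rw [differential_eq_diffOn]
  refine Finsupp.supported_mono Set.inter_subset_right
    (diffOn_mem_between (T := ∅) (B := ∅) (Finsupp.supported_mono (fun S hS => ?_) hz))
  exact And.intro ⟨Finset.empty_subset _, Finset.subset_univ _, by simp⟩ hS

theorem differential_differential (o : LinearOrder E) (z : Cochain ends b) :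
    differential ends o b (differential ends o b z) = 0 := by
  have := Fintype.ofFinite E
  rw [differential_eq_diffOn]
  exact diffOn_diffOn (isSign_sign o) _ z

theorem coboundaries_le_cocycles (o : LinearOrder E) (i j : ℤ) :
    coboundaries ends o b i j ≤ cocycles ends o b i j := by
  rintro _ ⟨z, hz, rfl⟩
  exact ⟨differential_mem_cochainGroup o hz, differential_differential o z⟩

theorem gradedStates_eq_empty_of_card_lt {i j : ℤ} (hi : (Nat.card E : ℤ) < i) :
    gradedStates ends b i j = ∅ :=
  Set.eq_empty_of_forall_notMem fun S hS => by
    have := Fintype.ofFinite E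
    have h1 := hS.1
    have h2 := S.edges.card_le_univ
    rw [← Nat.card_eq_fintype_card] at h2
    omega

theorem finrank_coboundaries_eq_zero (o : LinearOrder E) {i j : ℤ}
    (h : gradedStates ends b i j = ∅) : Module.finrank ℝ (coboundaries ends o b i j) = 0 := by
  have h2 : coboundaries ends o b i j ≤ cochainGroup ends b i j :=
    (coboundaries_le_cocycles o i j).trans inf_le_left
  rw [cochainGroup_eq_bot h, le_bot_iff] at h2
  rw [h2, finrank_bot]

variable [Finite V]

theorem finrank_cohomology_add (o : LinearOrder E) (i j : ℤ) :
    Module.finrank ℝ (Cohomology ends o b i j) + Module.finrank ℝ (coboundaries ends o b i j) =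
      Module.finrank ℝ (cocycles ends o b i j) := by
  rw [← Submodule.finrank_quotient_add_finrank
    ((coboundaries ends o b i j).submoduleOf (cocycles ends o b i j)),
    (Submodule.submoduleOfEquivOfLe (coboundaries_le_cocycles o i j)).finrank_eq]

theorem finrank_cocycles_add (o : LinearOrder E) (i j : ℤ) :
    Module.finrank ℝ (cocycles ends o b i j) + Module.finrank ℝ (coboundaries ends o b (i + 1) j) =
      Module.finrank ℝ (cochainGroup ends b i j) := by
  have h := LinearMap.finrank_range_add_finrank_ker
    ((differential ends o b).domRestrict (cochainGroup ends b i j))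
  rw [LinearMap.range_domRestrict, LinearMap.ker_domRestrict] at h
  rw [← h, coboundaries, add_sub_cancel_right, add_comm, cocycles,
    ← Submodule.map_comap_subtype, Submodule.finrank_map_subtype_eq]

theorem finrank_cochainGroup (i j : ℤ) :
    Module.finrank ℝ (cochainGroup ends b i j) = (gradedStates ends b i j).ncard := by
  have : Fintype (gradedStates ends b i j) := Fintype.ofFinite _
  have h : cochainGroup ends b i j = Finsupp.supported ℝ ℝ (gradedStates ends b i j) := rfl
  rw [h, (Finsupp.supportedEquivFinsupp (R := ℝ) (M := ℝ) _).finrank_eq,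
    Module.finrank_finsupp_self, ← Nat.card_eq_fintype_card]
  rfl

theorem finrank_cohomology_eq_zero_of_gradedStates (o : LinearOrder E) {i j : ℤ}
    (h : gradedStates ends b i j = ∅) : Module.finrank ℝ (Cohomology ends o b i j) = 0 := by
  have h1 := finrank_cohomology_add (ends := ends) (b := b) o i j
  have h2 : Module.finrank ℝ (cocycles ends o b i j) = 0 := by
    rw [cocycles, cochainGroup_eq_bot h, bot_inf_eq, finrank_bot]
  omega

/-- Euler–Poincaré for a truncated complex: the alternating sum telescopes up to the coboundaries at
both ends of the range. -/
theorem sum_finrank_cochainGroup_add (o : LinearOrder E) (j : ℤ) (N : ℕ) :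
    ∑ i ∈ Finset.range N, (-1 : ℤ) ^ i * (Module.finrank ℝ (cochainGroup ends b i j) : ℤ) +
      (-1) ^ N * (Module.finrank ℝ (coboundaries ends o b N j) : ℤ) =
    ∑ i ∈ Finset.range N, (-1 : ℤ) ^ i * (Module.finrank ℝ (Cohomology ends o b i j) : ℤ) +
      Module.finrank ℝ (coboundaries ends o b 0 j) := by
  induction N with
  | zero => simp
  | succ N ih =>
    rw [Finset.sum_range_succ, Finset.sum_range_succ, ← finrank_cocycles_add o,
      ← finrank_cohomology_add o]
    push_cast
    rw [pow_succ]
    linear_combination ih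

/-- The Euler characteristic in degree `j` of the reduced chromatic complex. -/
theorem sum_finrank_cohomology [Fintype (EnhancedState ends b)] (o : LinearOrder E) (j : ℤ) {N : ℕ}
    (hN : Nat.card E < N) :
    ∑ i ∈ Finset.range N, (-1 : ℤ) ^ i * (Module.finrank ℝ (Cohomology ends o b i j) : ℤ) =
      ∑ S : EnhancedState ends b with S.degree = j, (-1 : ℤ) ^ S.edges.card := by
  have h := sum_finrank_cochainGroup_add (ends := ends) (b := b) o j N
  rw [finrank_coboundaries_eq_zero o (gradedStates_eq_empty_of_card_lt (by exact_mod_cast hN))] at h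
  have h0 : Module.finrank ℝ (coboundaries ends o b 0 j) = 0 := by
    rw [coboundaries, cochainGroup_eq_bot (gradedStates_eq_empty_of_neg_left (by norm_num)),
      Submodule.map_bot, finrank_bot]
  rw [h0] at h
  simp only [Nat.cast_zero, mul_zero, add_zero] at h
  rw [← h, ← Finset.sum_fiberwise_of_maps_to (s := Finset.univ.filter fun S => S.degree = j)
    (t := Finset.range N) (g := fun S : EnhancedState ends b => S.edges.card)]
  · refine Finset.sum_congr rfl fun i _ => ?_
    rw [Finset.sum_congr rfl (g := fun _ => (-1 : ℤ) ^ i), Finset.sum_const, nsmul_eq_mul,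
      finrank_cochainGroup, mul_comm, Set.ncard_eq_toFinset_card']
    · congr 3
      ext S
      rw [Set.mem_toFinset, Finset.mem_filter, Finset.mem_filter]
      simp [gradedStates, and_comm]
    · intro S hS
      rw [(Finset.mem_filter.1 hS).2]
  · intro S _
    have := Fintype.ofFinite E
    rw [Nat.card_eq_fintype_card] at hN
    exact Finset.mem_range.2 (S.edges.card_le_univ.trans_lt hN)

/-- The hypothesis `hconn` speaks of any `s` containing all edges, so that no `Fintype E` instance
enters the statement. -/
theorem finrank_cohomology_eq_zero_of_add_ne (o : LinearOrder E)
    (hconn : ∀ s : Finset E, (∀ e, e ∈ s) → (stateGraph ends s).Connected) {i j : ℤ}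
    (hij : i + j ≠ numComponents ends ∅ - 1) :
    Module.finrank ℝ (Cohomology ends o b i j) = 0 := by
  have := Fintype.ofFinite E
  have hthin := isThin_univ (ends := ends) (b := b) (isSign_sign o) (hconn Finset.univ (by simp))
  have hst : statesBetween ends b ∅ Finset.univ {b} = Set.univ :=
    Set.eq_univ_of_forall fun S => ⟨Finset.empty_subset _, Finset.subset_univ _, by
      rintro β rfl
      exact S.color_base⟩
  have hle : cocycles ends o b i j ≤ coboundaries ends o b i j := by
    rintro z ⟨hz, hd⟩
    rw [differential_eq_diffOn] at hd
    obtain ⟨y, hy, hyz⟩ := hthin i j hij z (by rw [hst, Set.univ_inter]; exact hz) hd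
    rw [hst, Set.univ_inter] at hy
    refine ⟨y, hy, ?_⟩
    rw [differential_eq_diffOn]
    exact hyz
  have h1 := finrank_cohomology_add (ends := ends) (b := b) o i j
  have h2 := Submodule.finrank_mono hle
  omega

end Dimension

/-! ### Counting colourings: the Euler characteristic as a polynomial. -/

section Count

/-- The colourings by `1` and `x` of the components of a state, the component of the base point
being coloured by `x`. -/
abbrev Coloring (ends : E → Sym2 V) (b : V) (s : Finset E) : Type u :=
  {c : V → Color // (∀ v w, (stateGraph ends s).Reachable v w → c v = c w) ∧ c b = Color.x}

/-- An enhanced state is a set of edges with a colouring. -/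
def stateEquiv (ends : E → Sym2 V) (b : V) :
    (Σ s : Finset E, Coloring ends b s) ≃ EnhancedState ends b where
  toFun p := ⟨p.1, p.2.1, p.2.2.1, p.2.2.2⟩
  invFun S := ⟨S.edges, S.color, S.color_eq, S.color_base⟩
  left_inv _ := rfl
  right_inv _ := rfl

/-- A colouring is determined by the set of components, other than the component of the base
point, which are coloured by `x`. -/
noncomputable def coloringEquiv [Finite V] (ends : E → Sym2 V) (b : V) (s : Finset E) :
    Finset {K : (stateGraph ends s).ConnectedComponent //
      K ≠ (stateGraph ends s).connectedComponentMk b} ≃ Coloring ends b s :=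
  letI : Fintype V := Fintype.ofFinite V
  -- For the component of `b` no proof `h` exists, so the condition holds vacuously and the colour
  -- is x.
  { toFun A := ⟨fun v => if ∀ h, (⟨(stateGraph ends s).connectedComponentMk v, h⟩ :
        {K // K ≠ (stateGraph ends s).connectedComponentMk b}) ∈ A then Color.x else Color.one,
      fun v w h => by
        have : (stateGraph ends s).connectedComponentMk v =
          (stateGraph ends s).connectedComponentMk w := SimpleGraph.ConnectedComponent.sound h
        simp only [this], if_pos fun h => absurd rfl h⟩
    invFun c := Finset.univ.filter fun K =>
      ∃ v, (stateGraph ends s).connectedComponentMk v = K ∧ c.1 v = Color.x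
    left_inv A := by
      ext ⟨K, hK⟩
      simp only [Finset.mem_filter_univ, ite_eq_left_iff, reduceCtorEq, imp_false, not_not]
      constructor
      · rintro ⟨v, rfl, h⟩
        exact h hK
      · intro h
        induction K using SimpleGraph.ConnectedComponent.ind with | _ v
        exact ⟨v, rfl, fun _ => h⟩
    right_inv c := by
      refine Subtype.ext (funext fun v => Color.eq_of_iff ?_)
      simp only [Finset.mem_filter_univ, ite_eq_left_iff, reduceCtorEq, imp_false, not_not]
      constructor
      · intro h
        by_cases hv : (stateGraph ends s).connectedComponentMk v =
            (stateGraph ends s).connectedComponentMk b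
        · rw [c.2.1 v b (SimpleGraph.ConnectedComponent.exact hv), c.2.2]
        · obtain ⟨w, hw, hx⟩ := h hv
          exact (c.2.1 v w (SimpleGraph.ConnectedComponent.exact hw.symm)).trans hx
      · exact fun h _ => ⟨v, rfl, h⟩ }

theorem degree_coloringEquiv [Finite V] (s : Finset E)
    (A : Finset {K : (stateGraph ends s).ConnectedComponent //
      K ≠ (stateGraph ends s).connectedComponentMk b}) :
    (stateEquiv ends b ⟨s, coloringEquiv ends b s A⟩).degree = A.card := by
  have h : {K : (stateGraph ends s).ConnectedComponent |
      ∃ v, (stateGraph ends s).connectedComponentMk v = K ∧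
        (coloringEquiv ends b s A).1 v = Color.x} =
      ((insert ((stateGraph ends s).connectedComponentMk b) (A.image Subtype.val) : Finset _) :
        Set (stateGraph ends s).ConnectedComponent) := by
    ext K
    induction K using SimpleGraph.ConnectedComponent.ind with | _ v
    have hc : ((coloringEquiv ends b s A).1 v = Color.x) ↔
        ∀ h, (⟨(stateGraph ends s).connectedComponentMk v, h⟩ :
        {K // K ≠ (stateGraph ends s).connectedComponentMk b}) ∈ A := by
      simp [coloringEquiv]
    have h1 : (stateGraph ends s).connectedComponentMk v ∈
        {K : (stateGraph ends s).ConnectedComponent |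
      ∃ v, (stateGraph ends s).connectedComponentMk v = K ∧
        (coloringEquiv ends b s A).1 v = Color.x} ↔ (coloringEquiv ends b s A).1 v = Color.x := by
      constructor
      · rintro ⟨w, hw, hx⟩
        exact ((coloringEquiv ends b s A).2.1 _ _
          (SimpleGraph.ConnectedComponent.exact hw.symm)).trans hx
      · exact fun h => ⟨v, rfl, h⟩
    rw [h1, hc, Finset.mem_coe, Finset.mem_insert, Finset.mem_image]
    constructor
    · intro h
      by_cases hv : (stateGraph ends s).connectedComponentMk v =
            (stateGraph ends s).connectedComponentMk b
      · exact Or.inl hv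
      · exact Or.inr ⟨_, h hv, rfl⟩
    · rintro (h | ⟨K, hK, h⟩) hv
      · exact absurd h hv
      · have : K = ⟨(stateGraph ends s).connectedComponentMk v, hv⟩ := Subtype.ext h
        exact this ▸ hK
  have h2 : (stateEquiv ends b ⟨s, coloringEquiv ends b s A⟩).degree =
      ({K : (stateGraph ends s).ConnectedComponent |
        ∃ v, (stateGraph ends s).connectedComponentMk v = K ∧
          (coloringEquiv ends b s A).1 v = Color.x}.ncard : ℤ) - 1 := rfl
  rw [h2, h, Set.ncard_coe_finset, Finset.card_insert_of_notMem,
    Finset.card_image_of_injective _ Subtype.val_injective]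
  · push_cast
    ring
  · simp

theorem numComponents_pos [Finite V] (b : V) (s : Finset E) : 0 < numComponents ends s :=
  have : Nonempty (stateGraph ends s).ConnectedComponent :=
    ⟨(stateGraph ends s).connectedComponentMk b⟩
  Nat.card_pos

theorem card_components_ne [Finite V] (s : Finset E) :
    Nat.card {K : (stateGraph ends s).ConnectedComponent //
      K ≠ (stateGraph ends s).connectedComponentMk b} = numComponents ends s - 1 := by
  rw [numComponents, ← Nat.card_congr (Equiv.optionSubtypeNe
    ((stateGraph ends s).connectedComponentMk b)), Finite.card_option, Nat.add_sub_cancel]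

theorem card_coloring [Finite V] (s : Finset E) :
    Nat.card (Coloring ends b s) = 2 ^ (numComponents ends s - 1) := by
  have : Fintype {K : (stateGraph ends s).ConnectedComponent //
      K ≠ (stateGraph ends s).connectedComponentMk b} := Fintype.ofFinite _
  rw [← Nat.card_congr (coloringEquiv ends b s), Nat.card_eq_fintype_card, Fintype.card_finset,
    ← Nat.card_eq_fintype_card, card_components_ne]

open Polynomial in
/-- The graded Euler characteristic of the reduced chromatic complex. -/
noncomputable def eulerPoly [Fintype E] (ends : E → Sym2 V) : ℤ[X] :=
  ∑ s : Finset E, (-1) ^ s.card * (1 + X) ^ (numComponents ends s - 1)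

/-- A state of degree `l` on the edge set `s` is a choice of `l` of the k(s) - 1 components away
from `b`, which gives a binomial coefficient. -/
theorem sum_states_eq_coeff [Finite V] [Fintype E] [Fintype (EnhancedState ends b)] (l : ℕ) :
    ∑ S : EnhancedState ends b with S.degree = (l : ℤ), (-1 : ℤ) ^ S.edges.card =
      (eulerPoly ends).coeff l := by
  have : ∀ s, Fintype {K : (stateGraph ends s).ConnectedComponent //
      K ≠ (stateGraph ends s).connectedComponentMk b} := fun s => Fintype.ofFinite _
  rw [Finset.sum_filter, ← Equiv.sum_comp ((Equiv.sigmaCongrRight (coloringEquiv ends b)).trans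
    (stateEquiv ends b)), Fintype.sum_sigma, eulerPoly, Polynomial.finsetSum_coeff]
  refine Finset.sum_congr rfl fun s _ => ?_
  have h1 : ∀ A, (((Equiv.sigmaCongrRight (coloringEquiv ends b)).trans
      (stateEquiv ends b)) ⟨s, A⟩).degree = A.card := fun A => degree_coloringEquiv s A
  have h2 : ∀ A, (((Equiv.sigmaCongrRight (coloringEquiv ends b)).trans
      (stateEquiv ends b)) ⟨s, A⟩).edges = s := fun A => rfl
  simp only [h1, h2, Nat.cast_inj]
  rw [← Finset.sum_filter, Finset.sum_const]
  have h3 : (Finset.univ.filter fun A : Finset {K : (stateGraph ends s).ConnectedComponent //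
      K ≠ (stateGraph ends s).connectedComponentMk b} => A.card = l) =
      Finset.powersetCard l Finset.univ := by
    ext A
    simp [Finset.mem_powersetCard]
  have h4 : ((-1 : Polynomial ℤ) ^ s.card) = Polynomial.C ((-1) ^ s.card) := by simp
  rw [h3, Finset.card_powersetCard, Finset.card_univ, ← Nat.card_eq_fintype_card,
    card_components_ne, h4, Polynomial.coeff_C_mul, Polynomial.coeff_one_add_X_pow, nsmul_eq_mul,
    mul_comm]

theorem finrank_cohomology_diagonal [Finite V] [Fintype E] (o : LinearOrder E)
    (hconn : ∀ s : Finset E, (∀ e, e ∈ s) → (stateGraph ends s).Connected) {r : ℕ}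
    (hr : numComponents ends ∅ = r + 1) (l : ℕ) :
    (Module.finrank ℝ (Cohomology ends o b (r - l) l) : ℤ) =
      (-1) ^ (r + l) * (eulerPoly ends).coeff l := by
  have : Fintype (EnhancedState ends b) := Fintype.ofFinite _
  -- This bound exceeds the number of edges, as the Euler characteristic requires, and also `r`, so
  -- that the index `r - l` lies in the range.
  rw [← sum_states_eq_coeff (b := b), ← sum_finrank_cohomology o l
    (N := Nat.card E + r + 1) (by omega)]
  have hzero : ∀ i : ℤ, i ≠ r - l → Module.finrank ℝ (Cohomology ends o b i l) = 0 := fun i hi =>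
    finrank_cohomology_eq_zero_of_add_ne o hconn (by rw [hr]; push_cast; omega)
  -- For `l ≤ r` only the term `i = r - l` survives; for `l > r` that index is negative and both
  -- sides vanish.
  rcases le_or_gt l r with hl | hl
  · rw [Finset.sum_eq_single (r - l)]
    · rw [Nat.cast_sub hl, ← mul_assoc, ← pow_add]
      have : r + l + (r - l) = 2 * r := by omega
      rw [this, pow_mul]
      simp
    · intro i _ hi
      rw [hzero i (by omega)]
      simp
    · intro h
      exact absurd (Finset.mem_range.2 (by omega)) h
  · rw [Finset.sum_eq_zero, finrank_cohomology_eq_zero_of_gradedStates o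
      (gradedStates_eq_empty_of_neg_left (by omega))]
    · simp
    · intro i _
      rw [hzero i (by omega)]
      simp

end Count

end ReducedChromatic

/-! ### Gluing at a vertex: multiplicativity and the comparison of dimensions. -/

namespace ReducedChromatic

universe u v

open scoped Classical

/-- The finite set `t` carries all nonzero summands, so the dimension count makes sense for an
infinite index type such as `ℤ × ℤ`. -/
theorem nonempty_linearEquiv_directSum {ι : Type*} {M : ι → Type*} {H : Type*}
    [∀ i, AddCommMonoid (M i)] [∀ i, Module ℝ (M i)] [∀ i, Module.Free ℝ (M i)]
    [∀ i, Module.Finite ℝ (M i)]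
    [AddCommGroup H] [Module ℝ H] [Module.Finite ℝ H] (t : Finset ι)
    (ht : ∀ i, i ∉ t → Module.finrank ℝ (M i) = 0)
    (h : Module.finrank ℝ H = ∑ i ∈ t, Module.finrank ℝ (M i)) :
    Nonempty (H ≃ₗ[ℝ] ⨁ i, M i) := by
  let f : (Σ i : t, Fin (Module.finrank ℝ (M i))) → Σ i, Fin (Module.finrank ℝ (M i)) :=
    fun p => ⟨p.1, p.2⟩
  have hf : Function.Bijective f := by
    constructor
    · rintro ⟨⟨i, hi⟩, x⟩ ⟨⟨j, hj⟩, y⟩ hxy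
      simp only [f, Sigma.mk.injEq] at hxy
      obtain ⟨rfl, hxy⟩ := hxy
      rw [eq_of_heq hxy]
    · rintro ⟨i, x⟩
      have hi : i ∈ t := by
        by_contra hi
        exact Nat.not_lt_zero _ (x.2.trans_eq (ht i hi))
      exact ⟨⟨⟨i, hi⟩, x⟩, rfl⟩
  have hcard : Fintype.card (Σ i : t, Fin (Module.finrank ℝ (M i))) = Module.finrank ℝ H := by
    rw [Fintype.card_sigma, h, ← Finset.sum_coe_sort t]
    simp
  let e := (Fintype.equivFinOfCardEq hcard).symm.trans (Equiv.ofBijective f hf)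
  let B : Module.Basis (Σ i, Fin (Module.finrank ℝ (M i))) ℝ (⨁ i, M i) :=
    DFinsupp.basis fun i => Module.finBasis ℝ (M i)
  exact ⟨(Module.finBasis ℝ H).equiv B e⟩

section Glue

variable {V₁ : Type u} {V₂ : Type v} {v₁ : V₁} {v₂ : V₂}

/-- The inclusion of the first vertex set. -/
def glueInl (v₁ : V₁) (v₂ : V₂) (v : V₁) : GlueVertex v₁ v₂ := Quot.mk _ (Sum.inl v)

/-- The inclusion of the second vertex set. -/
def glueInr (v₁ : V₁) (v₂ : V₂) (v : V₂) : GlueVertex v₁ v₂ := Quot.mk _ (Sum.inr v)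

theorem glueInl_eq_glueInr : glueInl v₁ v₂ v₁ = glueInr v₁ v₂ v₂ := Quot.sound .glue

/-- A function on the glued vertex set which is given on both pieces. -/
def glueLift {α : Type*} (f : V₁ → α) (g : V₂ → α) (h : f v₁ = g v₂) : GlueVertex v₁ v₂ → α :=
  Quot.lift (Sum.elim f g) (by rintro _ _ ⟨⟩; exact h)

theorem glue_cases {P : GlueVertex v₁ v₂ → Prop} (hl : ∀ v, P (glueInl v₁ v₂ v))
    (hr : ∀ v, P (glueInr v₁ v₂ v)) (x : GlueVertex v₁ v₂) : P x := by
  induction x using Quot.ind with | _ x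
  cases x
  · exact hl _
  · exact hr _

theorem glueInl_injective : Function.Injective (glueInl v₁ v₂) :=
  Function.LeftInverse.injective (g := glueLift id (fun _ => v₁) rfl) fun _ => rfl

theorem glueInr_injective : Function.Injective (glueInr v₁ v₂) :=
  Function.LeftInverse.injective (g := glueLift (fun _ => v₂) id rfl) fun _ => rfl

end Glue

section Union

variable {V₁ : Type u} {V₂ : Type v} (Γ₁ : SimpleGraph V₁) (Γ₂ : SimpleGraph V₂) (v₁ : V₁) (v₂ : V₂)

/-- The first graph as a subgraph of the union. -/
def homInl : Γ₁ →g vertexUnion Γ₁ Γ₂ v₁ v₂ where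
  toFun := glueInl v₁ v₂
  map_rel' h := ⟨fun h' => h.ne (glueInl_injective h'), _, _,
    SimpleGraph.sum_adj_inl.2 h, rfl, rfl⟩

/-- The second graph as a subgraph of the union. -/
def homInr : Γ₂ →g vertexUnion Γ₁ Γ₂ v₁ v₂ where
  toFun := glueInr v₁ v₂
  map_rel' h := ⟨fun h' => h.ne (glueInr_injective h'), _, _,
    SimpleGraph.sum_adj_inr.2 h, rfl, rfl⟩

theorem vertexUnion_connected (h₁ : Γ₁.Connected) (h₂ : Γ₂.Connected) :
    (vertexUnion Γ₁ Γ₂ v₁ v₂).Connected := by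
  have h : ∀ x, (vertexUnion Γ₁ Γ₂ v₁ v₂).Reachable x (glueInl v₁ v₂ v₁) :=
    glue_cases (fun v => (h₁.preconnected v v₁).map (homInl Γ₁ Γ₂ v₁ v₂)) fun v => by
      rw [glueInl_eq_glueInr]
      exact (h₂.preconnected v v₂).map (homInr Γ₁ Γ₂ v₁ v₂)
  have : Nonempty (GlueVertex v₁ v₂) := ⟨glueInl v₁ v₂ v₁⟩
  exact ⟨fun x y => (h x).trans (h y).symm⟩

/-- The edges of the union are the edges of the two graphs. -/
noncomputable def edgeEquiv : Γ₁.edgeSet ⊕ Γ₂.edgeSet ≃ (vertexUnion Γ₁ Γ₂ v₁ v₂).edgeSet :=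
  Equiv.ofBijective (Sum.elim (homInl Γ₁ Γ₂ v₁ v₂).mapEdgeSet (homInr Γ₁ Γ₂ v₁ v₂).mapEdgeSet) (by
    have hdiag : ∀ (e₁ : Γ₁.edgeSet) (e₂ : Γ₂.edgeSet),
        (e₁ : Sym2 V₁).map (glueInl v₁ v₂) ≠ (e₂ : Sym2 V₂).map (glueInr v₁ v₂) := by
      intro e₁ e₂ h
      -- Collapsing the second graph to `v₁` turns its edges into loops and fixes the edges of the
      -- first graph, so no edge is common to both.
      have h' := congrArg (Sym2.map (glueLift (v₁ := v₁) (v₂ := v₂) id (fun _ => v₁) rfl)) h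
      rw [Sym2.map_map, Sym2.map_map] at h'
      have h1 : Sym2.map (glueLift (v₁ := v₁) (v₂ := v₂) id (fun _ => v₁) rfl ∘ glueInl v₁ v₂)
          (e₁ : Sym2 V₁) = e₁ := congrFun Sym2.map_id _
      have h2 : (Sym2.map (glueLift (v₁ := v₁) (v₂ := v₂) id (fun _ => v₁) rfl ∘ glueInr v₁ v₂)
          (e₂ : Sym2 V₂)).IsDiag := by
        induction (e₂ : Sym2 V₂) with | _ a c
        rfl
      rw [← h', h1] at h2
      exact Γ₁.not_isDiag_of_mem_edgeSet e₁.2 h2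
    constructor
    · rintro (e | e) (f | f) h
      · exact congrArg _ (Subtype.ext (Sym2.map.injective glueInl_injective
          (congrArg Subtype.val h)))
      · exact absurd (congrArg Subtype.val h) (hdiag e f)
      · exact absurd (congrArg Subtype.val h).symm (hdiag f e)
      · exact congrArg _ (Subtype.ext (Sym2.map.injective glueInr_injective
          (congrArg Subtype.val h)))
    · rintro ⟨e, he⟩
      induction e with | _ x y
      obtain ⟨_, a | a, c | c, h, hx, hy⟩ := he <;> dsimp only at hx hy <;> subst hx <;> subst hy
      · exact ⟨Sum.inl ⟨s(a, c), SimpleGraph.sum_adj_inl.1 h⟩, rfl⟩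
      · simp at h
      · simp at h
      · exact ⟨Sum.inr ⟨s(a, c), SimpleGraph.sum_adj_inr.1 h⟩, rfl⟩)

/-- The edge set of the union formed by edge sets of the two graphs. -/
noncomputable def edgeSetEquiv : Finset Γ₁.edgeSet × Finset Γ₂.edgeSet ≃
    Finset (vertexUnion Γ₁ Γ₂ v₁ v₂).edgeSet :=
  Finset.sumEquiv.symm.toEquiv.trans (edgeEquiv Γ₁ Γ₂ v₁ v₂).finsetCongr

theorem card_edgeSetEquiv (s : Finset Γ₁.edgeSet × Finset Γ₂.edgeSet) :
    (edgeSetEquiv Γ₁ Γ₂ v₁ v₂ s).card = s.1.card + s.2.card := by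
  simp [edgeSetEquiv]

theorem edgeSetEquiv_empty : edgeSetEquiv Γ₁ Γ₂ v₁ v₂ (∅, ∅) = ∅ := by
  rw [← Finset.card_eq_zero, card_edgeSetEquiv]
  simp

theorem forall_mem_edgeSetEquiv (s : Finset Γ₁.edgeSet × Finset Γ₂.edgeSet)
    (P : Sym2 (GlueVertex v₁ v₂) → Prop) :
    (∀ e ∈ edgeSetEquiv Γ₁ Γ₂ v₁ v₂ s, P e) ↔
      (∀ e ∈ s.1, P ((e : Sym2 V₁).map (glueInl v₁ v₂))) ∧
        ∀ e ∈ s.2, P ((e : Sym2 V₂).map (glueInr v₁ v₂)) := by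
  have h : ∀ x, edgeEquiv Γ₁ Γ₂ v₁ v₂ x ∈ edgeSetEquiv Γ₁ Γ₂ v₁ v₂ s ↔ x ∈ s.1.disjSum s.2 :=
    fun x => by simp [edgeSetEquiv]
  simp only [Equiv.forall_congr_left (edgeEquiv Γ₁ Γ₂ v₁ v₂).symm, Equiv.symm_symm, h, Sum.forall,
    Finset.inl_mem_disjSum, Finset.inr_mem_disjSum]
  rfl

/-- Tested edge by edge, the condition on colourings splits over the two edge sets of the union. -/
theorem forall_reachable_eq_iff {V : Type*} {E : Type*} {ends : E → Sym2 V} {s : Finset E}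
    {c : V → Color} : (∀ v w, (stateGraph ends s).Reachable v w → c v = c w) ↔
      ∀ e ∈ s, ((ends e).map c).IsDiag := by
  constructor
  · intro h e he
    have := fun v w (hvw : ends e = s(v, w)) => h v w (reachable_of_mem he hvw)
    generalize ends e = z at this
    induction z with | _ v w
    exact this v w rfl
  · intro h v w hr
    refine Reachable.induct (P := fun x => c v = c x) ?_ hr rfl
    intro e he p q hpq hp
    have := h e he
    rw [hpq] at this
    exact hp.trans this

/-- A colouring of the union consists of colourings of the two graphs. -/
noncomputable def coloringProdEquiv (s : Finset Γ₁.edgeSet × Finset Γ₂.edgeSet) :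
    Coloring (fun e : (vertexUnion Γ₁ Γ₂ v₁ v₂).edgeSet => (e : Sym2 (GlueVertex v₁ v₂))) (glueInl v₁ v₂ v₁)
      (edgeSetEquiv Γ₁ Γ₂ v₁ v₂ s) ≃
    Coloring (fun e : Γ₁.edgeSet => (e : Sym2 V₁)) v₁ s.1 ×
      Coloring (fun e : Γ₂.edgeSet => (e : Sym2 V₂)) v₂ s.2 :=
  have key : ∀ c : GlueVertex v₁ v₂ → Color,
      (∀ v w, (stateGraph (fun e : (vertexUnion Γ₁ Γ₂ v₁ v₂).edgeSet => (e : Sym2 (GlueVertex v₁ v₂)))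
        (edgeSetEquiv Γ₁ Γ₂ v₁ v₂ s)).Reachable v w → c v = c w) ↔
      (∀ v w, (stateGraph (fun e : Γ₁.edgeSet => (e : Sym2 V₁)) s.1).Reachable v w →
        (c ∘ glueInl v₁ v₂) v = (c ∘ glueInl v₁ v₂) w) ∧
      (∀ v w, (stateGraph (fun e : Γ₂.edgeSet => (e : Sym2 V₂)) s.2).Reachable v w →
        (c ∘ glueInr v₁ v₂) v = (c ∘ glueInr v₁ v₂) w) := fun c => by
    rw [forall_reachable_eq_iff, forall_reachable_eq_iff, forall_reachable_eq_iff,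
      forall_mem_edgeSetEquiv Γ₁ Γ₂ v₁ v₂ s fun e => (e.map c).IsDiag]
    simp only [Sym2.map_map]
  { toFun c := (⟨c.1 ∘ glueInl v₁ v₂, ((key c.1).1 c.2.1).1, c.2.2⟩,
      ⟨c.1 ∘ glueInr v₁ v₂, ((key c.1).1 c.2.1).2, by
        rw [Function.comp, ← glueInl_eq_glueInr]
        exact c.2.2⟩)
    invFun p := ⟨glueLift p.1.1 p.2.1 (p.1.2.2.trans p.2.2.2.symm),
      (key _).2 ⟨p.1.2.1, p.2.2.1⟩, p.1.2.2⟩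
    left_inv c := Subtype.ext (funext (glue_cases (fun _ => rfl) fun _ => rfl))
    right_inv _ := rfl }

/-- With the glued vertex as base point, colourings of the union are pairs of colourings. Their
numbers are powers of 2 with exponent k - 1, so comparing exponents gives additivity without
analysing components of the union. -/
theorem numComponents_edgeSetEquiv [Finite V₁] [Finite V₂]
    (s : Finset Γ₁.edgeSet × Finset Γ₂.edgeSet) :
    numComponents (fun e : (vertexUnion Γ₁ Γ₂ v₁ v₂).edgeSet => (e : Sym2 (GlueVertex v₁ v₂)))
      (edgeSetEquiv Γ₁ Γ₂ v₁ v₂ s) - 1 =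
    (numComponents (fun e : Γ₁.edgeSet => (e : Sym2 V₁)) s.1 - 1) +
      (numComponents (fun e : Γ₂.edgeSet => (e : Sym2 V₂)) s.2 - 1) := by
  have h := Nat.card_congr (coloringProdEquiv Γ₁ Γ₂ v₁ v₂ s)
  rw [Nat.card_prod, card_coloring, card_coloring, card_coloring, ← pow_add] at h
  exact Nat.pow_right_injective le_rfl h

theorem eulerPoly_vertexUnion [Finite V₁] [Finite V₂] [Fintype Γ₁.edgeSet] [Fintype Γ₂.edgeSet]
    [Fintype (vertexUnion Γ₁ Γ₂ v₁ v₂).edgeSet] :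
    eulerPoly (fun e : (vertexUnion Γ₁ Γ₂ v₁ v₂).edgeSet => (e : Sym2 (GlueVertex v₁ v₂))) =
      eulerPoly (fun e : Γ₁.edgeSet => (e : Sym2 V₁)) *
        eulerPoly (fun e : Γ₂.edgeSet => (e : Sym2 V₂)) := by
  rw [eulerPoly, ← Equiv.sum_comp (edgeSetEquiv Γ₁ Γ₂ v₁ v₂), eulerPoly, eulerPoly,
    Finset.sum_mul_sum, Fintype.sum_prod_type]
  refine Finset.sum_congr rfl fun s₁ _ => Finset.sum_congr rfl fun s₂ _ => ?_
  rw [numComponents_edgeSetEquiv, card_edgeSetEquiv, pow_add, pow_add]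
  ring

end Union

section Graph

variable {V : Type u} {Γ : SimpleGraph V}

theorem stateGraph_connected (hΓ : Γ.Connected) (s : Finset Γ.edgeSet) (hs : ∀ e, e ∈ s) :
    (stateGraph (fun e : Γ.edgeSet => (e : Sym2 V)) s).Connected := by
  have h : stateGraph (fun e : Γ.edgeSet => (e : Sym2 V)) s = Γ := by
    have h1 : (s : Set Γ.edgeSet) = Set.univ := Set.eq_univ_of_forall hs
    rw [stateGraph, h1, Set.image_univ, Subtype.range_coe, SimpleGraph.fromEdgeSet_edgeSet]
  rw [h]
  exact hΓ

variable [Finite V]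

/-- The rank of a graph: one less than the number of components of its edgeless spanning
subgraph. -/
noncomputable def graphRank (Γ : SimpleGraph V) : ℕ :=
  numComponents (fun e : Γ.edgeSet => (e : Sym2 V)) ∅ - 1

theorem add_eq_graphRank_and_nonneg (hΓ : Γ.Connected) (o : LinearOrder Γ.edgeSet) (b : V) {i j : ℤ}
    (h : Module.finrank ℝ (GraphCohomology Γ o b i j) ≠ 0) : i + j = graphRank Γ ∧ 0 ≤ j := by
  constructor
  · by_contra hij
    refine h (finrank_cohomology_eq_zero_of_add_ne o (stateGraph_connected hΓ) fun h' => hij ?_)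
    rw [h', graphRank, Nat.cast_sub (numComponents_pos b ∅)]
    rfl
  · by_contra hj
    exact h (finrank_cohomology_eq_zero_of_gradedStates o
      (gradedStates_eq_empty_of_neg_right (not_le.1 hj)))

theorem finrank_graphCohomology [Fintype Γ.edgeSet] (hΓ : Γ.Connected) (o : LinearOrder Γ.edgeSet)
    (b : V) (l : ℕ) : (Module.finrank ℝ (GraphCohomology Γ o b (graphRank Γ - l) l) : ℤ) =
      (-1) ^ (graphRank Γ + l) * (eulerPoly fun e : Γ.edgeSet => (e : Sym2 V)).coeff l :=
  finrank_cohomology_diagonal o (stateGraph_connected hΓ)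
    (Nat.sub_add_cancel (numComponents_pos b ∅)).symm l

instance (o : LinearOrder Γ.edgeSet) (b : V) (i j : ℤ) :
    Module.Finite ℝ (GraphCohomology Γ o b i j) := by
  have : Module.Finite ℝ (Cochain (fun e : Γ.edgeSet => (e : Sym2 V)) b) :=
    Module.Finite.finsupp
  infer_instance

instance (o : LinearOrder Γ.edgeSet) (b : V) (i j : ℤ) :
    Module.Free ℝ (GraphCohomology Γ o b i j) :=
  Module.Free.of_divisionRing ℝ _

end Graph

theorem graphRank_vertexUnion {V₁ : Type u} {V₂ : Type v} [Finite V₁] [Finite V₂]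
    (Γ₁ : SimpleGraph V₁) (Γ₂ : SimpleGraph V₂) (v₁ : V₁) (v₂ : V₂) :
    graphRank (vertexUnion Γ₁ Γ₂ v₁ v₂) = graphRank Γ₁ + graphRank Γ₂ := by
  have h := numComponents_edgeSetEquiv Γ₁ Γ₂ v₁ v₂ (∅, ∅)
  rwa [edgeSetEquiv_empty] at h

end ReducedChromatic

theorem mainTheorem4 {V₁ : Type*} {V₂ : Type*} [Finite V₁] [Finite V₂]
    (Γ₁ : SimpleGraph V₁) (Γ₂ : SimpleGraph V₂)
    (hΓ₁ : Γ₁.Connected) (hΓ₂ : Γ₂.Connected)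
    (v₁ : V₁) (v₂ : V₂)
    (b₁ : V₁) (b₂ : V₂) (b : ReducedChromatic.GlueVertex v₁ v₂)
    (o₁ : LinearOrder Γ₁.edgeSet) (o₂ : LinearOrder Γ₂.edgeSet)
    (o : LinearOrder (ReducedChromatic.vertexUnion Γ₁ Γ₂ v₁ v₂).edgeSet)
    (i j : ℤ) :
    Nonempty
      (ReducedChromatic.GraphCohomology (ReducedChromatic.vertexUnion Γ₁ Γ₂ v₁ v₂) o b i j
        ≃ₗ[ℝ]
      ⨁ p : ℤ × ℤ,
        ReducedChromatic.GraphCohomology Γ₁ o₁ b₁ p.1 p.2 ⊗[ℝ]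
          ReducedChromatic.GraphCohomology Γ₂ o₂ b₂ (i - p.1) (j - p.2)) := by
  open ReducedChromatic in
  have hΓ := vertexUnion_connected Γ₁ Γ₂ v₁ v₂ hΓ₁ hΓ₂
  have hr := graphRank_vertexUnion Γ₁ Γ₂ v₁ v₂
  have hdiag : ∀ p : ℤ × ℤ, Module.finrank ℝ (GraphCohomology Γ₁ o₁ b₁ p.1 p.2 ⊗[ℝ]
      GraphCohomology Γ₂ o₂ b₂ (i - p.1) (j - p.2)) ≠ 0 →
      (p.1 + p.2 = graphRank Γ₁ ∧ 0 ≤ p.2) ∧ i - p.1 + (j - p.2) = graphRank Γ₂ ∧ 0 ≤ j - p.2 := by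
    intro p hp
    rw [Module.finrank_tensorProduct, Nat.mul_ne_zero_iff] at hp
    exact ⟨add_eq_graphRank_and_nonneg hΓ₁ o₁ b₁ hp.1, add_eq_graphRank_and_nonneg hΓ₂ o₂ b₂ hp.2⟩
  -- Outside these bidegrees both sides are zero, by thinness, additivity of the rank and
  -- nonnegativity of degrees.
  by_cases h : i + j = graphRank (vertexUnion Γ₁ Γ₂ v₁ v₂) ∧ 0 ≤ j
  · obtain ⟨hij, hj⟩ := h
    obtain ⟨l, rfl⟩ := Int.eq_ofNat_of_zero_le hj
    obtain rfl : i = graphRank (vertexUnion Γ₁ Γ₂ v₁ v₂) - l := by omega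
    -- A summand can be nonzero only if both factors lie on their diagonals with nonnegative
    -- degrees; these are indexed by the ways to write `l` as a sum of two naturals.
    refine nonempty_linearEquiv_directSum (M := fun p : ℤ × ℤ =>
      GraphCohomology Γ₁ o₁ b₁ p.1 p.2 ⊗[ℝ] GraphCohomology Γ₂ o₂ b₂ (_ - p.1) (_ - p.2)) ((Finset.HasAntidiagonal.antidiagonal l).image fun q =>
      ((graphRank Γ₁ : ℤ) - q.1, (q.1 : ℤ))) (fun p hp => ?_) ?_
    · by_contra h0
      obtain ⟨⟨h1, h2⟩, -, h3⟩ := hdiag p h0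
      refine hp (Finset.mem_image.2 ⟨(p.2.toNat, l - p.2.toNat), ?_, ?_⟩)
      · rw [Finset.HasAntidiagonal.mem_antidiagonal]
        omega
      · ext <;> simp <;> omega
    · have := Fintype.ofFinite Γ₁.edgeSet
      have := Fintype.ofFinite Γ₂.edgeSet
      have := Fintype.ofFinite (vertexUnion Γ₁ Γ₂ v₁ v₂).edgeSet
      rw [Finset.sum_image (by
        intro q hq q' hq' h
        have h1 : (q.1 : ℤ) = q'.1 := congrArg Prod.snd h
        have h2 := Finset.HasAntidiagonal.mem_antidiagonal.1 hq
        have h3 := Finset.HasAntidiagonal.mem_antidiagonal.1 hq'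
        ext <;> omega)]
      zify
      -- The coefficients of the product polynomial form the same convolution as the dimensions of
      -- the tensor products, and the signs multiply correctly since ranks and degrees add.
      rw [finrank_graphCohomology hΓ, eulerPoly_vertexUnion, Polynomial.coeff_mul, Finset.mul_sum]
      refine Finset.sum_congr rfl fun q hq => ?_
      rw [Finset.HasAntidiagonal.mem_antidiagonal] at hq
      have h1 : (graphRank (vertexUnion Γ₁ Γ₂ v₁ v₂) : ℤ) - l - (graphRank Γ₁ - q.1) =
          graphRank Γ₂ - q.2 := by omega
      have h2 : (l : ℤ) - q.1 = q.2 := by omega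
      rw [Module.finrank_tensorProduct, h1, h2, Nat.cast_mul, finrank_graphCohomology hΓ₁,
        finrank_graphCohomology hΓ₂, hr, ← hq]
      ring
  · refine nonempty_linearEquiv_directSum (M := fun p : ℤ × ℤ =>
      GraphCohomology Γ₁ o₁ b₁ p.1 p.2 ⊗[ℝ] GraphCohomology Γ₂ o₂ b₂ (i - p.1) (j - p.2)) ∅ (fun p _ => ?_) ?_
    · by_contra h0
      have := hdiag p h0
      omega
    · rw [Finset.sum_empty]
      by_contra h0
      exact h (add_eq_graphRank_and_nonneg hΓ o b h0)
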